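/- Let $R>0$, $\gamma>1$, $c_v=\frac{R}{\gamma-1}$, and let $\mu,\lambda\in\mathbb R$ satisfy $\mu>0$ and $2\mu+\lambda>0$. Let $m\ge 3$ be an integer, let $R_0>0$, and let $\Omega\subset\mathbb R$ be either the half line $(0,\infty)$ or $\{x\in\mathbb R:|x|>r_0\}$ for some $0<r_0<R_0$. Consider on $\Omega$ the one-dimensional compressible Navier–Stokes equations for an ideal gas without heat conduction, $$\partial_t\rho+\partial_x(\rho u)=0,\qquad \partial_t(\rho u)+\partial_x(\rho u^2)-\partial_xS+\partial_xp=0,\qquad \partial_t(\rho E)+\partial_x\big(u(\rho E+p)\big)=\partial_x(Su),$$ where $E=\frac{u^2}{2}+c_v\theta$, $p=R\rho\theta$ and $S=(2\mu+\lambda)\,\partial_xu$, with the boundary conditions $u=0$ on $\partial\Omega$, $(u,\theta)(x,t)\to0$ as $|x|\to\infty$, and the initial condition $(\rho,u,\theta)|_{t=0}=(\rho_0,u_0,\theta_0)$. Suppose that $(\rho_0,u_0,\theta_0)\in H^m(\Omega)$ (elements of $H^m(\Omega)$ are identified with their continuous representatives), that $\rho_0\ge0$ in $\Omega$, that $\theta_0(x)>0$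 for every $x\in\Omega$ with $\rho_0(x)>0$, that $\operatorname{supp}\rho_0\subseteq B_{R_0}=\{x\in\mathbb R:|x|<R_0\}$, and that $\int_\Omega\rho_0\,dx>0$. No lower bound on the initial entropy $s_0=c_v\log\big(\tfrac{R}{A}\theta_0\rho_0^{1-\gamma}\big)$ ($A>0$ a constant) on $\{\rho_0>0\}$ is assumed. Then the initial-boundary value problem either has no local classical solution in the class $C^1([0,T];H^m(\Omega))$ at all, or any such local solution must blow up in finite time. Precisely: there is a finite time $T_*>0$, the same for all solutions with the given data, such that for no $T>T_*$ does there exist a classical solution $(\rho,u,\theta)\in C^1([0,T];H^m(\Omega))$ on $[0,T]$. -/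

import Mathlib

open Set Filter Topology MeasureTheory

noncomputable section

namespace CNS1D

/-- `φ ∈ C_c^∞(Ω)`: a smooth function with compact support contained in `Ω`. -/
structure IsTest (Ω : Set ℝ) (φ : ℝ → ℝ) : Prop where
  smooth : ContDiff ℝ (⊤ : ℕ∞) φ
  compact : HasCompactSupport φ
  support : tsupport φ ⊆ Ω

/-- `g` is the weak (distributional) derivative of order `k` of `f` on `Ω`. -/
def HasWeakDeriv (Ω : Set ℝ) (k : ℕ) (f g : ℝ → ℝ) : Prop :=
  ∀ φ : ℝ → ℝ, IsTest Ω φ →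
    ∫ x in Ω, f x * iteratedDeriv k φ x = (-1) ^ k * ∫ x in Ω, g x * φ x

theorem IsTest.continuous_iteratedDeriv {Ω : Set ℝ} {φ : ℝ → ℝ} (h : IsTest Ω φ) (k : ℕ) :
    Continuous (iteratedDeriv k φ) ∧ HasCompactSupport (iteratedDeriv k φ) := by
  refine ⟨h.smooth.continuous_iteratedDeriv k (by exact_mod_cast le_top), ?_⟩
  have h2 := h.compact.iteratedFDeriv (𝕜 := ℝ) k
  refine h2.mono ?_
  intro x hx
  simp only [Function.mem_support] at hx ⊢
  intro h0
  apply hx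
  rw [iteratedDeriv_eq_iteratedFDeriv, h0]
  simp

/-- The product of an `L²` function with a test function (or a derivative of one) is integrable. -/
theorem IsTest.integrable_mul {Ω : Set ℝ} {φ : ℝ → ℝ} (h : IsTest Ω φ) (k : ℕ)
    (f : Lp ℝ 2 (volume.restrict Ω)) :
    Integrable (fun x => f x * iteratedDeriv k φ x) (volume.restrict Ω) := by
  obtain ⟨hc, hs⟩ := h.continuous_iteratedDeriv k
  have h2 : MemLp (iteratedDeriv k φ) 2 (volume.restrict Ω) :=
    hc.memLp_of_hasCompactSupport hs
  exact (Lp.memLp f).integrable_mul h2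

/-- The Sobolev space `H^m(Ω) = W^{m,2}(Ω)` on an open set `Ω ⊆ ℝ`: an element is given by the
family `(w 0, …, w m)` of `L²(Ω)` functions in which `w k` is the weak derivative of order `k` of
`w 0` (and hence is determined by `w 0`). The norm inherited from the `ℓ²` product is the usual one,
`‖w‖² = ∑_{k ≤ m} ‖∂ₓᵏ w‖²_{L²(Ω)}`. -/
def Hm (m : ℕ) (Ω : Set ℝ) :
    Submodule ℝ (PiLp 2 fun _ : Fin (m + 1) => Lp ℝ 2 (volume.restrict Ω)) where
  carrier := {w | ∀ k : Fin (m + 1), HasWeakDeriv Ω k (w 0) (w k)}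
  zero_mem' := by
    intro k φ _
    have h0 : ((0 : Lp ℝ 2 (volume.restrict Ω)) : ℝ → ℝ) =ᵐ[volume.restrict Ω] 0 :=
      Lp.coeFn_zero _ _ _
    have h1 : ∀ ψ : ℝ → ℝ,
        ∫ x in Ω, (0 : Lp ℝ 2 (volume.restrict Ω)) x * ψ x = 0 := by
      intro ψ
      rw [integral_congr_ae (g := fun _ => (0 : ℝ)), integral_zero]
      filter_upwards [h0] with x hx
      rw [hx, Pi.zero_apply, zero_mul]
    simp only [PiLp.zero_apply, h1, mul_zero]
  add_mem' := by
    intro a b ha hb k φ hφ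
    have key : ∀ (j : ℕ) (f g : Lp ℝ 2 (volume.restrict Ω)),
        ∫ x in Ω, (f + g : Lp ℝ 2 (volume.restrict Ω)) x * iteratedDeriv j φ x
          = (∫ x in Ω, f x * iteratedDeriv j φ x) + ∫ x in Ω, g x * iteratedDeriv j φ x := by
      intro j f g
      rw [← integral_add (hφ.integrable_mul j f) (hφ.integrable_mul j g)]
      refine integral_congr_ae ?_
      filter_upwards [Lp.coeFn_add f g] with x hx
      rw [hx, Pi.add_apply, add_mul]
    have e1 := key k (a 0) (b 0)
    have e2 := key 0 (a k) (b k)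
    simp only [iteratedDeriv_zero] at e2
    simp only [PiLp.add_apply]
    rw [e1, e2, ha k φ hφ, hb k φ hφ, mul_add]
  smul_mem' := by
    intro c a ha k φ hφ
    have key : ∀ (ψ : ℝ → ℝ) (f : Lp ℝ 2 (volume.restrict Ω)),
        ∫ x in Ω, (c • f : Lp ℝ 2 (volume.restrict Ω)) x * ψ x = c * ∫ x in Ω, f x * ψ x := by
      intro ψ f
      rw [← integral_const_mul]
      refine integral_congr_ae ?_
      filter_upwards [Lp.coeFn_smul c f] with x hx
      rw [hx, Pi.smul_apply, smul_eq_mul, mul_assoc]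
    simp only [PiLp.smul_apply]
    rw [key, key, ha k φ hφ]
    ring

/-- The function `f` is the representative, continuous up to the boundary of `Ω`, of the element
`w` of `H^m(Ω)`. (Only the values of `f` on the closure of `Ω` matter.) -/
def IsContRep {m : ℕ} {Ω : Set ℝ} (w : Hm m Ω) (f : ℝ → ℝ) : Prop :=
  (w.1 0 : ℝ → ℝ) =ᵐ[volume.restrict Ω] f ∧ ContinuousOn f (closure Ω)

/-- `f ∈ H^m(Ω)` (where `m ≥ 1`, so that `f` is identified with its continuous representative). -/
def InHm (m : ℕ) (Ω : Set ℝ) (f : ℝ → ℝ) : Prop :=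
  ∃ w : Hm m Ω, IsContRep w f

/-- `f ∈ C¹([0,T]; H^m(Ω))`, with `f t x` the value at time `t` and position `x`: the curve
`t ↦ f t` is continuously differentiable, up to the end points, for the norm of `H^m(Ω)`. -/
def InC1Hm (m : ℕ) (Ω : Set ℝ) (T : ℝ) (f : ℝ → ℝ → ℝ) : Prop :=
  ∃ w : ℝ → Hm m Ω, ContDiffOn ℝ 1 w (Icc 0 T) ∧ ∀ t ∈ Icc 0 T, IsContRep (w t) (f t)

/-- The partial derivative in time of `f = f t x`. -/
def dt (f : ℝ → ℝ → ℝ) (t x : ℝ) : ℝ := deriv (fun s => f s x) t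

/-- The partial derivative in space of `f = f t x`. -/
def dx (f : ℝ → ℝ → ℝ) (t x : ℝ) : ℝ := deriv (fun y => f t y) x

/-- The pressure `p = R ρ θ`. -/
def pressure (R : ℝ) (ρ θ : ℝ → ℝ → ℝ) (t x : ℝ) : ℝ := R * ρ t x * θ t x

/-- The specific total energy `E = u² / 2 + c_v θ`, where `c_v = R / (γ - 1)`. -/
def energy (R γ : ℝ) (u θ : ℝ → ℝ → ℝ) (t x : ℝ) : ℝ := u t x ^ 2 / 2 + R / (γ - 1) * θ t x

/-- The stress `S = μ (∇u + (∇u)ᵀ) + lam (div u) I` in dimension one. -/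
def stress (μ lam : ℝ) (u : ℝ → ℝ → ℝ) (t x : ℝ) : ℝ :=
  μ * (dx u t x + dx u t x) + lam * dx u t x

/-- `(ρ, u, θ)` is a classical solution on `[0,T] × Ω`, in the class `C¹([0,T]; H^m(Ω))`, of the
one-dimensional compressible Navier–Stokes equations for an ideal gas without heat conduction,
with initial data `(ρ₀, u₀, θ₀)` and the boundary conditions `u = 0` on `∂Ω`, `(u, θ) → 0` at
infinity. For `m ≥ 3`, which is assumed where this is used, all derivatives in the equations exist
in the usual sense because of membership in `C¹([0,T]; H^m(Ω))`. -/
structure IsClassicalSolution (R γ μ lam : ℝ) (m : ℕ) (Ω : Set ℝ) (T : ℝ)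
    (ρ₀ u₀ θ₀ : ℝ → ℝ) (ρ u θ : ℝ → ℝ → ℝ) : Prop where
  rho_class : InC1Hm m Ω T ρ
  u_class : InC1Hm m Ω T u
  theta_class : InC1Hm m Ω T θ
  mass_eq : ∀ t ∈ Ioo 0 T, ∀ x ∈ Ω,
    dt ρ t x + dx (fun s y => ρ s y * u s y) t x = 0
  momentum_eq : ∀ t ∈ Ioo 0 T, ∀ x ∈ Ω,
    dt (fun s y => ρ s y * u s y) t x + dx (fun s y => ρ s y * u s y * u s y) t x
      - dx (stress μ lam u) t x + dx (pressure R ρ θ) t x = 0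
  energy_eq : ∀ t ∈ Ioo 0 T, ∀ x ∈ Ω,
    dt (fun s y => ρ s y * energy R γ u θ s y) t x
      + dx (fun s y => u s y * (ρ s y * energy R γ u θ s y + pressure R ρ θ s y)) t x
      = dx (fun s y => stress μ lam u s y * u s y) t x
  boundary : ∀ t ∈ Icc 0 T, ∀ x ∈ frontier Ω, u t x = 0
  u_infty : ∀ t ∈ Icc 0 T, Tendsto (u t) (cocompact ℝ ⊓ 𝓟 Ω) (𝓝 0)
  theta_infty : ∀ t ∈ Icc 0 T, Tendsto (θ t) (cocompact ℝ ⊓ 𝓟 Ω) (𝓝 0)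
  initial : ∀ x ∈ Ω, ρ 0 x = ρ₀ x ∧ u 0 x = u₀ x ∧ θ 0 x = θ₀ x

end CNS1D

end

namespace CNS1D

/-! Some gas lies on a component of `Ω`, which after a possible reflection is a half line with a
wall at `a`; the other component plays no role. Let the initial density vanish beyond `b`. In vacuum
the momentum equation reads `ν uxx = 0`, so beyond the gas `u` is affine in `x`, and being bounded
and zero at infinity it vanishes there (`velocity_eq_zero_of_vacuum`). This rigidity confines the
gas to `[a, b]` for all times (`density_eq_zero`): finite speed of propagation gives vacuum beyond
some `L`, integrating the momentum equation back from `L` bounds `u` at `b` by the mass that has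
escaped beyond `b`, and Grönwall shows that this mass stays zero.

Hence mass `M` and energy `E` on `[a, b]` are conserved, and the boundary terms drop out of the
virial identity: the derivative of `∫ (x - a) ρ u` is `∫ (ρ u² + p)`. The pressure stays
nonnegative, because viscous heating only raises it (`pressure_nonneg`); no entropy bound enters. So
the derivative is at least `min 2 (γ - 1) * E`, while the virial itself is at most `(b - a) (M / 2 +
E)` in absolute value. As `E > 0`, this bounds the life span by the data (`mul_energy_mul_time_le`).

The rest is regularity. The continuous representative of an `H^m` function is an explicit integral
expression in two consecutive weak derivatives, so point evaluations are functionals bounded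
uniformly in the point (`exists_contDeriv_functional`). This turns curves in `C¹([0,T]; H^m)` into
classically differentiable functions. -/

/-! ### Weak derivatives on a half line: the du Bois-Reymond lemma and continuous representatives -/

theorem IsTest.exists_tsupport_subset_Icc {a : ℝ} {φ : ℝ → ℝ} (h : IsTest (Ioi a) φ) :
    ∃ p q : ℝ, a < p ∧ p < q ∧ tsupport φ ⊆ Icc p q := by
  rcases (tsupport φ).eq_empty_or_nonempty with he | hne
  · exact ⟨a + 1, a + 2, by linarith, by linarith, by simp [he]⟩
  · obtain ⟨p, hp⟩ := h.compact.isCompact.exists_isLeast hne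
    obtain ⟨q, hq⟩ := h.compact.isCompact.exists_isGreatest hne
    have h1 : a < p := h.support hp.1
    exact ⟨p, q + 1, h1, by linarith [hp.2 hq.1], fun x hx => ⟨hp.2 hx, by linarith [hq.2 hx]⟩⟩

theorem isTest_deriv {Ω : Set ℝ} {φ : ℝ → ℝ} (h : IsTest Ω φ) : IsTest Ω (deriv φ) :=
  ⟨(contDiff_infty_iff_deriv.1 h.smooth).2, h.compact.deriv,
    (tsupport_deriv_subset).trans h.support⟩

theorem IsTest.sub_const_mul {Ω : Set ℝ} {φ ψ : ℝ → ℝ} (h : IsTest Ω φ) (h' : IsTest Ω ψ) (c : ℝ) :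
    IsTest Ω (fun x => φ x - c * ψ x) := by
  refine ⟨h.smooth.sub (contDiff_const.mul h'.smooth), ?_, ?_⟩
  · exact h.compact.sub (h'.compact.mul_left (f := fun _ => c))
  · refine (tsupport_sub (f := φ) (g := fun x => c * ψ x)).trans (union_subset h.support ?_)
    exact (tsupport_mul_subset_right (f := fun _ => c) (g := ψ)).trans h'.support

theorem integral_eq_intervalIntegral_of_tsupport_subset {f : ℝ → ℝ} {p q : ℝ} (hpq : p ≤ q)
    {s : Set ℝ} (hms : MeasurableSet s) (hs : Icc p q ⊆ s) (h : ∀ x, x ∉ Icc p q → f x = 0) :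
    ∫ x in s, f x = ∫ x in p..q, f x := by
  rw [intervalIntegral.integral_of_le hpq, ← integral_Icc_eq_integral_Ioc]
  exact setIntegral_eq_of_subset_of_forall_sdiff_eq_zero hms hs fun x hx => h x hx.2

/-- A test function on a half line with zero mean is the derivative of a test function. -/
theorem IsTest.exists_deriv_eq {a : ℝ} {ζ : ℝ → ℝ} (h : IsTest (Ioi a) ζ)
    (h0 : ∫ x in Ioi a, ζ x = 0) : ∃ χ : ℝ → ℝ, IsTest (Ioi a) χ ∧ ∀ x, deriv χ x = ζ x := by
  obtain ⟨p, q, hap, hpq, hs⟩ := h.exists_tsupport_subset_Icc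
  have hz : ∀ x, x ∉ Icc p q → ζ x = 0 := fun x hx => image_eq_zero_of_notMem_tsupport
    fun hx' => hx (hs hx')
  have hc : Continuous ζ := h.smooth.continuous
  have hd : ∀ x, HasDerivAt (fun y => ∫ s in p..y, ζ s) (ζ x) x := fun x =>
    intervalIntegral.integral_hasDerivAt_right (hc.intervalIntegrable _ _)
      (hc.stronglyMeasurableAtFilter _ _) hc.continuousAt
  have hχ : ∀ x, x ∉ Icc p q → (∫ s in p..x, ζ s) = 0 := by
    intro x hx
    rcases lt_or_ge x p with hxp | hxp
    · rw [intervalIntegral.integral_symm, intervalIntegral.integral_of_le hxp.le]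
      rw [setIntegral_eq_zero_of_ae_eq_zero, neg_zero]
      have : ∀ᵐ y : ℝ, y ≠ p := by simp [ae_iff, measure_singleton]
      filter_upwards [this] with y hy hy'
      exact hz y fun hh => hy (le_antisymm hy'.2 hh.1)
    · have hxq : q < x := by
        by_contra hh
        exact hx ⟨hxp, not_lt.1 hh⟩
      rw [← h0, integral_eq_intervalIntegral_of_tsupport_subset (s := Ioi a) (p := p) (q := x)
        (by linarith) measurableSet_Ioi (fun y hy => lt_of_lt_of_le hap hy.1)]
      intro y hy
      exact hz y fun hh => hy ⟨hh.1, hh.2.trans hxq.le⟩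
  have hsupp : Function.support (fun y => ∫ s in p..y, ζ s) ⊆ Icc p q := by
    intro x hx
    by_contra hh
    exact hx (hχ x hh)
  refine ⟨fun y => ∫ s in p..y, ζ s, ⟨?_, ?_, ?_⟩, fun x => (hd x).deriv⟩
  · rw [contDiff_infty_iff_deriv]
    refine ⟨fun x => (hd x).differentiableAt, ?_⟩
    have : deriv (fun y => ∫ s in p..y, ζ s) = ζ := funext fun x => (hd x).deriv
    rw [this]
    exact h.smooth
  · exact HasCompactSupport.of_support_subset_isCompact isCompact_Icc hsupp
  · exact (closure_minimal hsupp isClosed_Icc).trans fun y hy => lt_of_lt_of_le hap hy.1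

theorem exists_isTest_integral_eq_one (a : ℝ) :
    ∃ ψ : ℝ → ℝ, IsTest (Ioi a) ψ ∧ ∫ x in Ioi a, ψ x = 1 := by
  let B : ContDiffBump (a + 2) := ⟨1 / 2, 1, by norm_num, by norm_num⟩
  have hsub : tsupport (B.normed volume) ⊆ Ioi a := by
    rw [B.tsupport_normed_eq, Real.closedBall_eq_Icc]
    intro x hx
    have := hx.1
    have h1 : B.rOut = 1 := rfl
    rw [h1] at this
    simp only [mem_Ioi]
    linarith
  refine ⟨B.normed volume, ⟨B.contDiff_normed, B.hasCompactSupport_normed, hsub⟩, ?_⟩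
  rw [setIntegral_eq_integral_of_forall_compl_eq_zero, B.integral_normed]
  intro x hx
  exact image_eq_zero_of_notMem_tsupport fun h => hx (hsub h)

theorem IsTest.integrableOn_mul {a : ℝ} {F φ : ℝ → ℝ} (hφ : IsTest (Ioi a) φ)
    (hF : LocallyIntegrableOn F (Ioi a)) : IntegrableOn (fun x => F x * φ x) (Ioi a) := by
  have h1 : IntegrableOn F (tsupport φ) := hF.integrableOn_compact_subset hφ.support
    hφ.compact.isCompact
  have h2 : IntegrableOn (fun x => F x * φ x) (tsupport φ) :=
    h1.mul_continuousOn hφ.smooth.continuous.continuousOn hφ.compact.isCompact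
  refine (h2.of_forall_sdiff_eq_zero measurableSet_Ioi ?_)
  intro x hx
  rw [image_eq_zero_of_notMem_tsupport hx.2, mul_zero]

/-- The du Bois-Reymond lemma on a half line. -/
theorem ae_eq_const_of_integral_mul_deriv_eq_zero {a : ℝ} {F : ℝ → ℝ}
    (hF : LocallyIntegrableOn F (Ioi a))
    (h : ∀ φ, IsTest (Ioi a) φ → ∫ x in Ioi a, F x * deriv φ x = 0) :
    ∃ k : ℝ, F =ᵐ[volume.restrict (Ioi a)] fun _ => k := by
  obtain ⟨ψ, hψ, hψ1⟩ := exists_isTest_integral_eq_one a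
  refine ⟨∫ x in Ioi a, F x * ψ x, ?_⟩
  set k := ∫ x in Ioi a, F x * ψ x with hk
  have key := isOpen_Ioi.ae_eq_zero_of_integral_contDiff_smul_eq_zero (μ := volume) (U := Ioi a)
    (f := fun x => F x - k) (hF.sub (locallyIntegrableOn_const k)) ?_
  · rw [EventuallyEq, ae_restrict_iff' measurableSet_Ioi]
    filter_upwards [key] with x hx hx'
    linarith [hx hx']
  intro φ hφ1 hφ2 hφ3
  have hφ : IsTest (Ioi a) φ := ⟨hφ1, hφ2, hφ3⟩
  have hφi : IntegrableOn φ (Ioi a) :=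
    (hφ.smooth.continuous.integrable_of_hasCompactSupport hφ.compact).integrableOn
  have hψi : IntegrableOn ψ (Ioi a) :=
    (hψ.smooth.continuous.integrable_of_hasCompactSupport hψ.compact).integrableOn
  rw [← setIntegral_eq_integral_of_forall_compl_eq_zero (s := Ioi a)]
  swap
  · intro x hx
    rw [image_eq_zero_of_notMem_tsupport fun h => hx (hφ3 h), zero_smul]
  -- Subtracting `c * ψ` makes the mean zero, so `φ - c * ψ` is the derivative of a test function
  -- and the hypothesis applies to it.
  set c := ∫ x in Ioi a, φ x with hc
  obtain ⟨χ, hχ, hχ'⟩ := (hφ.sub_const_mul hψ c).exists_deriv_eq (by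
    rw [integral_sub hφi (hψi.const_mul c), integral_const_mul, hψ1]; simp [hc])
  have h3 := h χ hχ
  simp only [hχ'] at h3
  have e1 : ∀ x, F x * (φ x - c * ψ x) = F x * φ x - c * (F x * ψ x) := fun x => by ring
  simp only [e1] at h3
  rw [integral_sub (hφ.integrableOn_mul hF) ((hψ.integrableOn_mul hF).const_mul c), integral_const_mul, ← hk] at h3
  have e2 : ∀ x, φ x • (F x - k) = F x * φ x - k * φ x := fun x => by simp only [smul_eq_mul]; ring
  simp only [e2]
  rw [integral_sub (hφ.integrableOn_mul hF) (hφi.const_mul k), integral_const_mul, ← hc]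
  linarith

/-- The continuous representative of a function `g` with weak derivative `h`, as an explicit
linear expression in `(g, h)`. -/
noncomputable def slidingMean (g h : ℝ → ℝ) (x : ℝ) : ℝ :=
  (∫ s in x..x + 1, g s) - ∫ s in x..x + 1, (x + 1 - s) * h s

theorem slidingMean_of_weakDeriv {a : ℝ} {g h : ℝ → ℝ}
    (hg : ∀ b, IntegrableOn g (Icc a b)) (hh : ∀ b, IntegrableOn h (Icc a b))
    (hw : ∀ φ, IsTest (Ioi a) φ →
      ∫ x in Ioi a, g x * deriv φ x = -∫ x in Ioi a, h x * φ x) :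
    g =ᵐ[volume.restrict (Ioi a)] slidingMean g h ∧
      ∀ x y, a ≤ x → a ≤ y → slidingMean g h y - slidingMean g h x = ∫ s in x..y, h s := by
  have hii : ∀ x y, a ≤ x → a ≤ y → IntervalIntegrable h volume x y := by
    intro x y hx hy
    rw [intervalIntegrable_iff]
    refine (hh (max x y)).mono_set ?_
    exact uIoc_subset_uIcc.trans fun z hz => ⟨le_trans (le_min hx hy) hz.1, hz.2⟩
  set G : ℝ → ℝ := fun x => ∫ s in a..x, h s with hG
  have hac : ∀ x y, a ≤ x → a ≤ y → AbsolutelyContinuousOnInterval G x y := by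
    intro x y hx hy
    have h1 : AbsolutelyContinuousOnInterval G a (max x y) :=
      (hii a (max x y) le_rfl (le_max_of_le_left hx)).absolutelyContinuousOnInterval_intervalIntegral
        left_mem_uIcc
    refine h1.mono ?_
    rw [uIcc_of_le (le_max_of_le_left hx)]
    exact fun z hz => ⟨le_trans (le_min hx hy) hz.1, hz.2⟩
  have hGd : ∀ x y, a ≤ x → x ≤ y → ∀ᵐ z, z ∈ Ioc x y → deriv G z = h z := by
    intro x y hx hxy
    have := (hii a y le_rfl (hx.trans hxy)).ae_hasDerivAt_integral
    filter_upwards [this] with z hz hz'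
    refine (hz ?_ a left_mem_uIcc).deriv
    rw [uIcc_of_le (hx.trans hxy)]
    exact ⟨hx.trans hz'.1.le, hz'.2⟩
  have ibp : ∀ x y, a ≤ x → x ≤ y → ∀ φ : ℝ → ℝ, ContDiff ℝ 1 φ →
      ∫ s in x..y, G s * deriv φ s = G y * φ y - G x * φ x - ∫ s in x..y, h s * φ s := by
    intro x y hx hxy φ hφ
    rw [(hac x y hx (hx.trans hxy)).integral_mul_deriv_eq_deriv_mul
      hφ.contDiffOn.absolutelyContinuousOnInterval]
    congr 1
    refine intervalIntegral.integral_congr_ae ?_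
    rw [uIoc_of_le hxy]
    filter_upwards [hGd x y hx hxy] with z hz hz'
    rw [hz hz']
  have hGcont : ∀ b, ContinuousOn G (Icc a b) := by
    intro b
    rcases le_total a b with hab | hab
    · have := (hac a b le_rfl hab).continuousOn
      rwa [uIcc_of_le hab] at this
    · refine (continuousOn_singleton G a).mono fun z hz => ?_
      exact le_antisymm (hz.2.trans hab) hz.1
  have hGint : ∀ b, IntegrableOn G (Icc a b) := fun b => (hGcont b).integrableOn_compact isCompact_Icc
  have hloc : ∀ f : ℝ → ℝ, (∀ b, IntegrableOn f (Icc a b)) → LocallyIntegrableOn f (Ioi a) := by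
    intro f hf
    rw [locallyIntegrableOn_iff isOpen_Ioi.isLocallyClosed]
    intro K hK hKc
    obtain ⟨b, hb⟩ := hKc.bddAbove
    exact (hf b).mono_set fun x hx => ⟨le_of_lt (hK hx), hb hx⟩
  have hFw : ∀ φ, IsTest (Ioi a) φ → ∫ x in Ioi a, (g - G) x * deriv φ x = 0 := by
    intro φ hφ
    obtain ⟨p, q, hap, hpq, hs⟩ := hφ.exists_tsupport_subset_Icc
    have hz : ∀ x, x ∉ Icc p q → φ x = 0 := fun x hx => image_eq_zero_of_notMem_tsupport
      fun hx' => hx (hs hx')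
    have hz' : ∀ x, x ∉ Icc p q → deriv φ x = 0 := fun x hx => image_eq_zero_of_notMem_tsupport
      fun hx' => hx (hs (tsupport_deriv_subset hx'))
    -- The interval is enlarged within the half line so that `φ` vanishes at both end points and the
    -- boundary terms disappear.
    have hmem : ∀ x, x ∉ Icc ((a + p) / 2) (q + 1) → x ∉ Icc p q := fun x hx hx' =>
      hx ⟨by linarith [hx'.1], by linarith [hx'.2]⟩
    have hsub : Icc ((a + p) / 2) (q + 1) ⊆ Ioi a := fun x hx =>
      lt_of_lt_of_le (by linarith : a < (a + p) / 2) hx.1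
    have h1 := hw φ hφ
    have h2 := ibp ((a + p) / 2) (q + 1) (by linarith) (by linarith) φ
      (hφ.smooth.of_le (by exact_mod_cast le_top))
    rw [hz (q + 1) fun h => by linarith [h.2], hz ((a + p) / 2) fun h => by linarith [h.1],
      ← integral_eq_intervalIntegral_of_tsupport_subset (by linarith) measurableSet_Ioi hsub
        (fun x hx => by rw [hz' x (hmem x hx), mul_zero]),
      ← integral_eq_intervalIntegral_of_tsupport_subset (by linarith) measurableSet_Ioi hsub
        (fun x hx => by rw [hz x (hmem x hx), mul_zero])] at h2
    simp only [Pi.sub_apply, sub_mul]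
    rw [integral_sub ((isTest_deriv hφ).integrableOn_mul (hloc g hg))
      ((isTest_deriv hφ).integrableOn_mul (hloc G hGint)), h1, h2]
    ring
  obtain ⟨k, hk⟩ := ae_eq_const_of_integral_mul_deriv_eq_zero ((hloc g hg).sub (hloc G hGint)) hFw
  have hsm : ∀ x, a ≤ x → slidingMean g h x = G x + k := by
    intro x hx
    -- This weight is `1` at the left end of the window, `0` at the right end, and has slope `-1`:
    -- only the boundary value `G x` survives.
    have h1 := ibp x (x + 1) hx (by linarith) (fun s => x + 1 - s)
      (contDiff_const.sub contDiff_id)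
    have h2 : deriv (fun s : ℝ => x + 1 - s) = fun _ => -1 := by
      ext s
      simp
    have h3 : ∫ s in x..x + 1, g s = ∫ s in x..x + 1, (G s + k) := by
      refine intervalIntegral.integral_congr_ae ?_
      rw [EventuallyEq, ae_restrict_iff' measurableSet_Ioi] at hk
      filter_upwards [hk] with z hz hz'
      rw [uIoc_of_le (by linarith)] at hz'
      have := hz (lt_of_le_of_lt hx hz'.1)
      rw [Pi.sub_apply] at this
      linarith
    have h4 : IntervalIntegrable G volume x (x + 1) := by
      rw [intervalIntegrable_iff_integrableOn_Ioc_of_le (by linarith)]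
      exact (hGint (x + 1)).mono_set fun z hz => ⟨hx.trans hz.1.le, hz.2⟩
    rw [h2] at h1
    simp only [mul_neg, mul_one, intervalIntegral.integral_neg] at h1
    have h5 : ∫ s in x..x + 1, h s * (x + 1 - s) = ∫ s in x..x + 1, (x + 1 - s) * h s := by
      simp only [mul_comm]
    rw [h5] at h1
    rw [slidingMean, h3, intervalIntegral.integral_add h4 (by simp),
      intervalIntegral.integral_const]
    simp only [smul_eq_mul]
    linarith
  refine ⟨?_, ?_⟩
  · rw [EventuallyEq, ae_restrict_iff' measurableSet_Ioi] at hk ⊢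
    filter_upwards [hk] with x hx hx'
    rw [hsm x (le_of_lt hx'), ← hx hx', Pi.sub_apply]
    ring
  · intro x y hx hy
    rw [hsm x hx, hsm y hy, add_sub_add_right_eq_sub]
    exact intervalIntegral.integral_interval_sub_left (hii a y le_rfl hy) (hii a x le_rfl hx)

/-! ### Sobolev functions on an oriented half line and bounded point evaluations -/

/-- The orientation `σ = ±1` carries the half line `(a, ∞)` into the open set `Ω`. -/
structure IsHalfLineIn (Ω : Set ℝ) (σ a : ℝ) : Prop where
  sq : σ * σ = 1
  isOpen : IsOpen Ω
  mem : ∀ x, a < x → σ * x ∈ Ω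

theorem measurePreserving_mul_of_sq {σ : ℝ} (h : σ * σ = 1) :
    MeasurePreserving (fun x : ℝ => σ * x) := by
  rcases mul_self_eq_one_iff.1 h with rfl | rfl
  · simp only [one_mul]
    exact MeasurePreserving.id volume
  · simpa using Measure.measurePreserving_neg (volume : Measure ℝ)

theorem measurableEmbedding_mul_of_sq {σ : ℝ} (h : σ * σ = 1) :
    MeasurableEmbedding (fun x : ℝ => σ * x) :=
  measurableEmbedding_mulLeft₀ (left_ne_zero_of_mul_eq_one h)

/-- The weight `κ` restricted to the window `(x, x + 1]`. -/
noncomputable def window (κ : ℝ → ℝ) (x : ℝ) : ℝ → ℝ := (Ioc x (x + 1)).indicator κ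

theorem memLp_window {κ : ℝ → ℝ} (hκ : Continuous κ) {x : ℝ}
    (hb : ∀ s ∈ Ioc x (x + 1), |κ s| ≤ 1) :
    MemLp (window κ x) 2 ∧ eLpNorm (window κ x) 2 ≤ 1 := by
  have hae : ∀ᵐ s ∂(volume.restrict (Ioc x (x + 1))), ‖κ s‖ ≤ 1 := by
    rw [ae_restrict_iff' measurableSet_Ioc]
    exact Eventually.of_forall hb
  constructor
  · rw [window, memLp_indicator_iff_restrict measurableSet_Ioc]
    exact MemLp.of_bound hκ.aestronglyMeasurable 1 hae
  · rw [window, eLpNorm_indicator_eq_eLpNorm_restrict measurableSet_Ioc]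
    refine (eLpNorm_le_of_ae_bound hae).trans ?_
    simp

theorem memLp_window_comp {σ : ℝ} (hσ : σ * σ = 1) (Ω : Set ℝ) {κ : ℝ → ℝ} (hκ : Continuous κ)
    {x : ℝ} (hb : ∀ s ∈ Ioc x (x + 1), |κ s| ≤ 1) :
    MemLp (fun y => window κ x (σ * y)) 2 (volume.restrict Ω) :=
  ((memLp_window hκ hb).1.comp_measurePreserving (measurePreserving_mul_of_sq hσ)).restrict Ω

/-- Integration over a window against a bounded weight is a bounded functional on `L²`, uniformly in
the position of the window. -/
theorem exists_windowFunctional {Ω : Set ℝ} (hΩ : IsOpen Ω) {σ : ℝ} (hσ : σ * σ = 1) {κ : ℝ → ℝ}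
    (hκ : Continuous κ) {x : ℝ} (hb : ∀ s ∈ Ioc x (x + 1), |κ s| ≤ 1) :
    ∃ ℓ : Lp ℝ 2 (volume.restrict Ω) →L[ℝ] ℝ, (∀ v, |ℓ v| ≤ ‖v‖) ∧
      ∀ v, ℓ v = ∫ s in x..x + 1, κ s * Ω.indicator v (σ * s) := by
  have hm := memLp_window_comp hσ Ω hκ hb
  have hn : ‖hm.toLp _‖ ≤ 1 := by
    rw [Lp.norm_toLp]
    refine ENNReal.toReal_le_of_le_ofReal zero_le_one ?_
    rw [ENNReal.ofReal_one]
    refine (eLpNorm_restrict_le _ _ _ _).trans ?_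
    have := eLpNorm_comp_measurePreserving (p := 2) (memLp_window hκ hb).1.1
      (measurePreserving_mul_of_sq hσ)
    exact this.le.trans (memLp_window hκ hb).2
  refine ⟨innerSL ℝ (hm.toLp _), fun v => ?_, fun v => ?_⟩
  · have h1 := abs_real_inner_le_norm (hm.toLp _) v
    have h2 : ‖hm.toLp _‖ * ‖v‖ ≤ 1 * ‖v‖ := mul_le_mul_of_nonneg_right hn (norm_nonneg _)
    rw [one_mul] at h2
    exact h1.trans h2
  · rw [innerSL_apply_apply, L2.inner_def]
    have e1 : ∫ y in Ω, inner ℝ ((hm.toLp _) y) (v y) =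
        ∫ y in Ω, window κ x (σ * y) * v y := by
      refine integral_congr_ae ?_
      filter_upwards [hm.coeFn_toLp] with y hy
      rw [hy]
      simp [mul_comm]
    rw [e1, ← integral_indicator hΩ.measurableSet,
      ← (measurePreserving_mul_of_sq hσ).integral_comp (measurableEmbedding_mul_of_sq hσ),
      intervalIntegral.integral_of_le (by linarith), ← integral_indicator measurableSet_Ioc]
    refine integral_congr_ae (Eventually.of_forall fun s => ?_)
    have hs : σ * (σ * s) = s := by rw [← mul_assoc, hσ, one_mul]
    classical
    simp only [indicator_apply, window, hs]
    split_ifs <;> simp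

/-- The `k`-th weak derivative of `w`, transported to the half line by the orientation `σ`. -/
noncomputable def orientedDeriv {m : ℕ} {Ω : Set ℝ} (σ : ℝ) (w : Hm m Ω) (k : ℕ) (s : ℝ) : ℝ :=
  σ ^ k * Ω.indicator (w.1 (Fin.ofNat (m + 1) k)) (σ * s)

/-- The continuous representative of `orientedDeriv σ w k`. -/
noncomputable def contDeriv {m : ℕ} {Ω : Set ℝ} (σ : ℝ) (w : Hm m Ω) (k : ℕ) : ℝ → ℝ :=
  slidingMean (orientedDeriv σ w k) (orientedDeriv σ w (k + 1))

/-- The sliding mean is linear in two `L²` components, each tested on a window of length one against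
a weight bounded by `1`; each contributes at most `‖w‖`. The bound does not depend on `x`, which is
what yields both joint continuity and pointwise time derivatives for curves in `H^m`. -/
theorem exists_contDeriv_functional {m : ℕ} {Ω : Set ℝ} {σ a : ℝ} (h : IsHalfLineIn Ω σ a)
    (k : ℕ) (x : ℝ) :
    ∃ ℓ : Hm m Ω →L[ℝ] ℝ, (∀ w, |ℓ w| ≤ 2 * ‖w‖) ∧ ∀ w, ℓ w = contDeriv σ w k x := by
  obtain ⟨ℓ₁, hn₁, hℓ₁⟩ := exists_windowFunctional h.isOpen h.sq (κ := fun _ => 1) (x := x)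
    continuous_const (by simp)
  obtain ⟨ℓ₂, hn₂, hℓ₂⟩ := exists_windowFunctional h.isOpen h.sq (κ := fun s => x + 1 - s) (x := x)
    (by fun_prop) (fun s hs => by
      rw [abs_le]
      constructor <;> linarith [hs.1, hs.2])
  let pr (j : ℕ) : Hm m Ω →L[ℝ] Lp ℝ 2 (volume.restrict Ω) :=
    (PiLp.proj 2 (𝕜 := ℝ) (fun _ : Fin (m + 1) => Lp ℝ 2 (volume.restrict Ω))
      (Fin.ofNat (m + 1) j)).comp (Hm m Ω).subtypeL
  have hpr : ∀ j w, pr j w = w.1 (Fin.ofNat (m + 1) j) := fun j w => rfl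
  have hprn : ∀ j w, ‖pr j w‖ ≤ ‖w‖ := fun j w => PiLp.norm_apply_le w.1 _
  have hσ : |σ| = 1 := by
    rcases mul_self_eq_one_iff.1 h.sq with rfl | rfl <;> simp
  refine ⟨σ ^ k • ℓ₁.comp (pr k) - σ ^ (k + 1) • ℓ₂.comp (pr (k + 1)), fun w => ?_, fun w => ?_⟩
  · simp only [sub_apply, smul_apply,
      ContinuousLinearMap.comp_apply, smul_eq_mul]
    refine (abs_sub _ _).trans ?_
    rw [abs_mul, abs_mul, abs_pow, abs_pow, hσ, one_pow, one_pow, one_mul, one_mul, two_mul]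
    exact add_le_add ((hn₁ _).trans (hprn _ _)) ((hn₂ _).trans (hprn _ _))
  · simp only [sub_apply, smul_apply,
      ContinuousLinearMap.comp_apply, smul_eq_mul, contDeriv, slidingMean, orientedDeriv, hℓ₁, hℓ₂,
      hpr, one_mul]
    rw [← intervalIntegral.integral_const_mul, ← intervalIntegral.integral_const_mul]
    congr 1
    refine intervalIntegral.integral_congr fun s _ => ?_
    ring

theorem integrableOn_orientedDeriv {m : ℕ} {Ω : Set ℝ} {σ a : ℝ} (h : IsHalfLineIn Ω σ a)
    (w : Hm m Ω) (k : ℕ) (b : ℝ) : IntegrableOn (orientedDeriv σ w k) (Icc a b) := by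
  have h1 : MemLp (Ω.indicator (w.1 (Fin.ofNat (m + 1) k))) 2 :=
    (memLp_indicator_iff_restrict h.isOpen.measurableSet).2 (Lp.memLp _)
  have h2 := (h1.comp_measurePreserving (measurePreserving_mul_of_sq h.sq)).const_mul (σ ^ k)
  exact (h2.restrict (Icc a b)).integrable (by norm_num)

theorem iteratedDeriv_comp_mul (σ : ℝ) {φ : ℝ → ℝ} (hφ : ContDiff ℝ (⊤ : ℕ∞) φ) (k : ℕ) (x : ℝ) :
    iteratedDeriv k (fun y => φ (σ * y)) x = σ ^ k * iteratedDeriv k φ (σ * x) := by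
  have := iteratedDeriv_comp_const_mul (n := k) (f := φ) (hφ.of_le (by exact_mod_cast le_top)) σ
  exact congrFun this x

theorem IsTest.comp_mul {Ω : Set ℝ} {σ a : ℝ} (h : IsHalfLineIn Ω σ a) {φ : ℝ → ℝ}
    (hφ : IsTest (Ioi a) φ) : IsTest Ω (fun y => φ (σ * y)) := by
  have hσ0 : σ ≠ 0 := left_ne_zero_of_mul_eq_one h.sq
  let e : ℝ ≃ₜ ℝ := Homeomorph.mulLeft₀ σ hσ0
  have he : (fun y => φ (σ * y)) = φ ∘ e := rfl
  refine ⟨hφ.smooth.comp (contDiff_const.mul contDiff_id), ?_, ?_⟩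
  · rw [he]
    exact hφ.compact.comp_homeomorph e
  · rw [he, tsupport_comp_eq_preimage]
    intro y hy
    have h1 : a < σ * y := hφ.support hy
    have := h.mem _ h1
    rwa [← mul_assoc, h.sq, one_mul] at this

theorem integral_mul_comp {Ω : Set ℝ} {σ a : ℝ} (h : IsHalfLineIn Ω σ a) (f φ : ℝ → ℝ)
    (hφ : tsupport φ ⊆ Ioi a) :
    ∫ y in Ω, f y * φ (σ * y) = ∫ s in Ioi a, Ω.indicator f (σ * s) * φ s := by
  rw [← integral_indicator h.isOpen.measurableSet,
    ← (measurePreserving_mul_of_sq h.sq).integral_comp (measurableEmbedding_mul_of_sq h.sq),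
    ← integral_indicator measurableSet_Ioi]
  refine integral_congr_ae (Eventually.of_forall fun s => ?_)
  have hs : σ * (σ * s) = s := by rw [← mul_assoc, h.sq, one_mul]
  classical
  by_cases hsa : a < s
  · simp only [indicator_apply, hs, h.mem s hsa, mem_Ioi, hsa, if_true]
  · have : φ s = 0 := image_eq_zero_of_notMem_tsupport fun hh => hsa (hφ hh)
    simp only [indicator_apply, hs, this, mul_zero, ite_self]

/-- Membership in `Hm` relates each component only to `w 0`. Consecutive components are compared by
testing order `k` with `φ'` and order `k + 1` with `φ`: both integrals reduce to `w 0` against the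
derivative of order `k + 1` of `φ`. The factor `σ ^ k` in `orientedDeriv` absorbs the reflection. -/
theorem orientedDeriv_weakDeriv {m : ℕ} {Ω : Set ℝ} {σ a : ℝ} (h : IsHalfLineIn Ω σ a)
    (w : Hm m Ω) {k : ℕ} (hk : k < m) (φ : ℝ → ℝ) (hφ : IsTest (Ioi a) φ) :
    ∫ x in Ioi a, orientedDeriv σ w k x * deriv φ x =
      -∫ x in Ioi a, orientedDeriv σ w (k + 1) x * φ x := by
  -- `Fin.ofNat` reduces modulo `m + 1`, so it names the intended derivative only for orders up to
  -- `m`.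
  have hval : ∀ j, j ≤ m → (Fin.ofNat (m + 1) j : ℕ) = j := fun j hj => by
    rw [Fin.val_ofNat, Nat.mod_eq_of_lt (Nat.lt_succ_of_le hj)]
  have hφ' := isTest_deriv hφ
  have hσ0 : σ ≠ 0 := left_ne_zero_of_mul_eq_one h.sq
  have e1 := w.2 (Fin.ofNat (m + 1) (k + 1)) _ (hφ.comp_mul h)
  have e2 := w.2 (Fin.ofNat (m + 1) k) _ (hφ'.comp_mul h)
  rw [hval _ hk] at e1
  rw [hval _ hk.le] at e2
  simp only [iteratedDeriv_comp_mul σ hφ.smooth, iteratedDeriv_comp_mul σ hφ'.smooth,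
    ← iteratedDeriv_succ'] at e1 e2
  rw [integral_mul_comp h _ _ hφ.support] at e1
  rw [integral_mul_comp h _ _ hφ'.support] at e2
  simp only [mul_left_comm _ (σ ^ _), integral_const_mul] at e1 e2
  simp only [orientedDeriv, mul_assoc, integral_const_mul]
  set A := ∫ x in Ω, w.1 0 x * iteratedDeriv (k + 1) φ (σ * x)
  set B := ∫ x in Ioi a, Ω.indicator (w.1 (Fin.ofNat (m + 1) (k + 1))) (σ * x) * φ x
  set C := ∫ x in Ioi a, Ω.indicator (w.1 (Fin.ofNat (m + 1) k)) (σ * x) * deriv φ x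
  rw [pow_succ, pow_succ] at e1
  have hk1 : ((-1 : ℝ) ^ k) * (-1) ^ k = 1 := by rw [← mul_pow]; simp
  have hC : C = (-1) ^ k * (σ ^ k * A) := by rw [e2, ← mul_assoc, hk1, one_mul]
  have hB : B = -((-1) ^ k * (σ ^ k * σ * A)) := by
    rw [e1]
    linear_combination (-B) * hk1
  have hσk : σ ^ k * σ ^ k = 1 := by rw [← mul_pow, h.sq, one_pow]
  rw [hC, hB, pow_succ]
  linear_combination (-(-1) ^ k * A * σ ^ k * σ ^ k) * h.sq

section representative

variable {m : ℕ} {Ω : Set ℝ} {σ a : ℝ} (h : IsHalfLineIn Ω σ a) (w : Hm m Ω)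
include h

theorem contDeriv_spec {k : ℕ} (hk : k < m) :
    orientedDeriv σ w k =ᵐ[volume.restrict (Ioi a)] contDeriv σ w k ∧
      ∀ x y, a ≤ x → a ≤ y →
        contDeriv σ w k y - contDeriv σ w k x = ∫ s in x..y, orientedDeriv σ w (k + 1) s :=
  slidingMean_of_weakDeriv (integrableOn_orientedDeriv h w k)
    (integrableOn_orientedDeriv h w (k + 1)) (orientedDeriv_weakDeriv h w hk)

end representative

section representative

variable {m : ℕ} {Ω : Set ℝ} {σ a : ℝ} (h : IsHalfLineIn Ω σ a) (w : Hm m Ω) {k : ℕ}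
include h

theorem continuousOn_contDeriv (hk : k < m) : ContinuousOn (contDeriv σ w k) (Ici a) := by
  have key : ∀ b, a ≤ b → ContinuousOn (contDeriv σ w k) (Icc a b) := by
    intro b hab
    have h1 : IntervalIntegrable (orientedDeriv σ w (k + 1)) volume a b :=
      (intervalIntegrable_iff_integrableOn_Ioc_of_le hab).2
        ((integrableOn_orientedDeriv h w (k + 1) b).mono_set Ioc_subset_Icc_self)
    have h2 := intervalIntegral.continuousOn_primitive_interval' h1 left_mem_uIcc
    rw [uIcc_of_le hab] at h2
    refine (h2.const_add (contDeriv σ w k a)).congr fun x hx => ?_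
    linarith [(contDeriv_spec h w hk).2 a x le_rfl hx.1]
  intro x hx
  refine (key (x + 1) (by linarith [mem_Ici.1 hx]) x ⟨hx, by linarith⟩).mono_of_mem_nhdsWithin ?_
  rw [← Ici_inter_Iic]
  exact inter_mem_nhdsWithin _ (Iic_mem_nhds (by linarith))

theorem hasDerivAt_contDeriv (hk : k + 1 < m) {x : ℝ} (hx : a < x) :
    HasDerivAt (contDeriv σ w k) (contDeriv σ w (k + 1) x) x := by
  have hspec := contDeriv_spec h w (k := k) (by omega)
  have hae := (contDeriv_spec h w hk).1
  have hc := continuousOn_contDeriv h w hk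
  have hci : ∀ y z, a ≤ y → a ≤ z → IntervalIntegrable (contDeriv σ w (k + 1)) volume y z :=
    fun y z hy hz => (hc.mono fun s hs => le_trans (le_min hy hz) hs.1).intervalIntegrable
  have heq : ∀ y, a ≤ y → contDeriv σ w k y =
      contDeriv σ w k x + ∫ s in x..y, contDeriv σ w (k + 1) s := by
    intro y hy
    have : ∫ s in x..y, contDeriv σ w (k + 1) s = ∫ s in x..y, orientedDeriv σ w (k + 1) s := by
      refine intervalIntegral.integral_congr_ae ?_
      rw [EventuallyEq, ae_restrict_iff' measurableSet_Ioi] at hae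
      filter_upwards [hae] with s hs hs'
      exact (hs (lt_of_le_of_lt (le_min hx.le hy) hs'.1)).symm
    rw [this, ← hspec.2 x y hx.le hy]
    ring
  have hd : HasDerivAt (fun y => contDeriv σ w k x + ∫ s in x..y, contDeriv σ w (k + 1) s)
      (contDeriv σ w (k + 1) x) x := by
    refine HasDerivAt.const_add _ (intervalIntegral.integral_hasDerivAt_right (hci x x hx.le hx.le) ?_
      (hc.continuousAt (Ici_mem_nhds hx)))
    exact (hc.mono Ioi_subset_Ici_self).stronglyMeasurableAtFilter isOpen_Ioi x hx
  refine hd.congr_of_eventuallyEq ?_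
  filter_upwards [Ioi_mem_nhds hx] with y hy
  exact heq y (le_of_lt hy)

/-- Both sides are continuous on the closed half line and agree almost everywhere, hence agree
everywhere, including at the wall. -/
theorem IsContRep.eq_contDeriv {w : Hm m Ω} (hm : 0 < m) {f : ℝ → ℝ} (hf : IsContRep w f) {x : ℝ}
    (hx : a ≤ x) : f (σ * x) = contDeriv σ w 0 x := by
  have hae : (fun x => f (σ * x)) =ᵐ[volume.restrict (Ioi a)] contDeriv σ w 0 := by
    have h1 := (contDeriv_spec h w hm).1
    have h2 := hf.1
    rw [EventuallyEq, ae_restrict_iff' h.isOpen.measurableSet] at h2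
    have h3 := (measurePreserving_mul_of_sq h.sq).quasiMeasurePreserving.ae h2
    rw [EventuallyEq, ae_restrict_iff' measurableSet_Ioi] at h1 ⊢
    filter_upwards [h1, h3] with y hy hy' hya
    have hyΩ := h.mem y hya
    rw [← hy hya, ← hy' hyΩ]
    simp [orientedDeriv, indicator_of_mem hyΩ]
  have hmaps : MapsTo (fun x => σ * x) (Ici a) (closure Ω) := by
    rw [← closure_Ioi]
    exact MapsTo.closure (fun y hy => h.mem y hy) (by fun_prop)
  have hfc : ContinuousOn (fun x => f (σ * x)) (Ici a) :=
    hf.2.comp (by fun_prop) hmaps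
  have hae' : (fun x => f (σ * x)) =ᵐ[volume.restrict (Ici a)] contDeriv σ w 0 := by
    rwa [← restrict_Ioi_eq_restrict_Ici]
  exact Measure.eqOn_of_ae_eq hae' hfc (continuousOn_contDeriv h w hm) (by simp) hx

end representative

/-! ### From curves in `H^m` to classical derivatives in space and time -/

/-- `f = f t x` has partial derivatives `fx` and `ft`, and all three are continuous up to the
boundary of `[0, T] × [a, ∞)`. -/
structure IsC1Field (T a : ℝ) (f fx ft : ℝ → ℝ → ℝ) : Prop where
  cont : ContinuousOn (Function.uncurry f) (Icc 0 T ×ˢ Ici a)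
  cont_dx : ContinuousOn (Function.uncurry fx) (Icc 0 T ×ˢ Ici a)
  cont_dt : ContinuousOn (Function.uncurry ft) (Icc 0 T ×ˢ Ici a)
  hasDerivAt_dx : ∀ t ∈ Icc 0 T, ∀ x, a < x → HasDerivAt (f t) (fx t x) x
  hasDerivAt_dt : ∀ t ∈ Ioo 0 T, ∀ x, a ≤ x → HasDerivAt (fun s => f s x) (ft t x) t

/-- Evaluation is continuous in `x` for fixed `w` and `2`-Lipschitz in `w` uniformly in `x`, hence
jointly continuous. -/
theorem continuousOn_contDeriv_curve {m : ℕ} {Ω : Set ℝ} {σ a : ℝ} (h : IsHalfLineIn Ω σ a) {k : ℕ}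
    (hk : k < m) {v : ℝ → Hm m Ω} {s : Set ℝ} (hv : ContinuousOn v s) :
    ContinuousOn (Function.uncurry fun t x => contDeriv σ (v t) k x) (s ×ˢ Ici a) := by
  have h1 : ContinuousOn (fun p : Hm m Ω × ℝ => contDeriv σ p.1 k p.2) (univ ×ˢ Ici a) := by
    refine continuousOn_prod_of_continuousOn_lipschitzOnWith _ 2
      (fun w _ => continuousOn_contDeriv h w hk)
      (fun x _ => LipschitzOnWith.of_dist_le_mul fun w _ w' _ => ?_)
    obtain ⟨ℓ, hn, hℓ⟩ := exists_contDeriv_functional (m := m) h k x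
    simp only [← hℓ]
    rw [Real.dist_eq, ← map_sub, dist_eq_norm]
    exact hn _
  refine h1.comp (f := fun p : ℝ × ℝ => (v p.1, p.2)) ?_ fun p hp => ⟨mem_univ _, hp.2⟩
  exact (hv.comp continuousOn_fst fun p hp => hp.1).prodMk continuousOn_snd

/-- Curves in `C¹([0, T]; H^m)`, `m ≥ 3`, are classically differentiable on each half line. -/
theorem InC1Hm.exists_isC1Field {m : ℕ} (hm : 2 < m) {Ω : Set ℝ} {σ a T : ℝ} (hT : 0 < T)
    (h : IsHalfLineIn Ω σ a) {f : ℝ → ℝ → ℝ} (hf : InC1Hm m Ω T f) :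
    ∃ fx fxx ft : ℝ → ℝ → ℝ, IsC1Field T a (fun t x => f t (σ * x)) fx ft ∧
      ContinuousOn (Function.uncurry fxx) (Icc 0 T ×ˢ Ici a) ∧
      (∀ t ∈ Icc 0 T, ∀ x, a < x → HasDerivAt (fx t) (fxx t x) x) ∧
      ∃ C, ∀ t ∈ Icc 0 T, ∀ x, a ≤ x → |f t (σ * x)| ≤ C := by
  obtain ⟨w, hw, hrep⟩ := hf
  have heq : ∀ t ∈ Icc 0 T, ∀ x, a ≤ x → f t (σ * x) = contDeriv σ (w t) 0 x :=
    fun t ht x hx => (hrep t ht).eq_contDeriv h (by omega) hx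
  have hwc : ContinuousOn w (Icc 0 T) := hw.continuousOn
  have hw'c : ContinuousOn (derivWithin w (Icc 0 T)) (Icc 0 T) :=
    hw.continuousOn_derivWithin (uniqueDiffOn_Icc hT) le_rfl
  refine ⟨fun t x => contDeriv σ (w t) 1 x, fun t x => contDeriv σ (w t) 2 x,
    fun t x => contDeriv σ (derivWithin w (Icc 0 T) t) 0 x, ⟨?_, ?_, ?_, ?_, ?_⟩, ?_, ?_, ?_⟩
  · exact (continuousOn_contDeriv_curve h (k := 0) (by omega) hwc).congr
      fun p hp => heq p.1 hp.1 p.2 hp.2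
  · exact continuousOn_contDeriv_curve h (by omega) hwc
  · exact continuousOn_contDeriv_curve h (by omega) hw'c
  · intro t ht x hx
    refine (hasDerivAt_contDeriv h (w t) (k := 0) (by omega) hx).congr_of_eventuallyEq ?_
    filter_upwards [Ioi_mem_nhds hx] with y hy
    exact heq t ht y (le_of_lt hy)
  · intro t ht x hx
    -- Evaluation at `x` is a continuous linear functional, so it commutes with the time derivative
    -- of the curve.
    obtain ⟨ℓ, hn, hℓ⟩ := exists_contDeriv_functional (m := m) h 0 x
    have hd : HasDerivAt w (derivWithin w (Icc 0 T) t) t :=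
      ((hw.differentiableOn one_ne_zero t (Ioo_subset_Icc_self ht)).hasDerivWithinAt).hasDerivAt
        (Icc_mem_nhds ht.1 ht.2)
    have := ℓ.hasFDerivAt.comp_hasDerivAt t hd
    simp only [hℓ] at this
    refine this.congr_of_eventuallyEq ?_
    filter_upwards [Icc_mem_nhds ht.1 ht.2] with s hs
    simp [heq s hs x hx, hℓ]
  · exact continuousOn_contDeriv_curve h (by omega) hwc
  · exact fun t ht x hx => hasDerivAt_contDeriv h (w t) (by omega) hx
  · obtain ⟨C, hC⟩ := (isCompact_Icc.image_of_continuousOn hwc).isBounded.exists_norm_le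
    refine ⟨2 * C, fun t ht x hx => ?_⟩
    obtain ⟨ℓ, hn, hℓ⟩ := exists_contDeriv_functional (m := m) h 0 x
    rw [heq t ht x hx, ← hℓ]
    exact (hn _).trans (by linarith [hC _ (mem_image_of_mem w ht)])

/-! ### Calculus of jointly `C¹` functions -/

section calculus

/-- Joint continuity on `[0, T] × [a, ∞)`. -/
abbrev ContOn (T a : ℝ) (f : ℝ → ℝ → ℝ) : Prop :=
  ContinuousOn (Function.uncurry f) (Icc 0 T ×ˢ Ici a)

variable {T a α β t : ℝ} {f fx ft g gx gt : ℝ → ℝ → ℝ}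

theorem ContOn.slice (hf : ContOn T a f) (ht : t ∈ Icc 0 T) : ContinuousOn (f t) (Ici a) :=
  ContinuousOn.comp (g := Function.uncurry f) (f := fun x => (t, x)) hf (by fun_prop)
    fun _ hx => ⟨ht, hx⟩

theorem ContOn.intervalIntegrable (hf : ContOn T a f) (ht : t ∈ Icc 0 T) (hα : a ≤ α) (hβ : a ≤ β) :
    IntervalIntegrable (f t) volume α β :=
  ((hf.slice ht).mono fun _ hx => le_trans (le_min hα hβ) hx.1).intervalIntegrable

theorem ContOn.mul (hf : ContOn T a f) (hg : ContOn T a g) : ContOn T a fun t x => f t x * g t x :=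
  ContinuousOn.mul hf hg

theorem ContOn.exists_bound (hf : ContOn T a f) (β : ℝ) :
    ∃ C, 0 ≤ C ∧ ∀ t ∈ Icc 0 T, ∀ x ∈ Icc a β, |f t x| ≤ C := by
  have hK : IsCompact (Icc 0 T ×ˢ Icc a β) := isCompact_Icc.prod isCompact_Icc
  have hc : ContinuousOn (Function.uncurry f) (Icc 0 T ×ˢ Icc a β) :=
    hf.mono (prod_mono_right fun x hx => hx.1)
  obtain ⟨C, hC⟩ := (hK.image_of_continuousOn hc).isBounded.exists_norm_le
  refine ⟨max C 0, le_max_right _ _, fun t ht x hx => le_max_of_le_left ?_⟩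
  exact hC _ (mem_image_of_mem (Function.uncurry f) (mk_mem_prod ht hx : (t, x) ∈ _))

theorem ContOn.integral_dx (hf : ContOn T a f) (hfx : ContOn T a fx) (ht : t ∈ Icc 0 T)
    (hd : ∀ x, a < x → HasDerivAt (f t) (fx t x) x) (hα : a ≤ α) (hαβ : α ≤ β) :
    ∫ x in α..β, fx t x = f t β - f t α :=
  intervalIntegral.integral_eq_sub_of_hasDerivAt_of_le hαβ
    ((hf.slice ht).mono fun _ hx => hα.trans hx.1) (fun x hx => hd x (lt_of_le_of_lt hα hx.1))
    (hfx.intervalIntegrable ht hα (hα.trans hαβ))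

theorem ContOn.continuousOn_integral (hf : ContOn T a f) (hα : a ≤ α) (hαβ : α ≤ β) :
    ContinuousOn (fun t => ∫ x in α..β, f t x) (Icc 0 T) := by
  obtain ⟨C, _, hC⟩ := hf.exists_bound β
  intro t ht
  refine intervalIntegral.continuousWithinAt_of_dominated_interval (bound := fun _ => C) ?_ ?_ ?_ ?_
  · filter_upwards [self_mem_nhdsWithin] with s hs
    exact (hf.intervalIntegrable hs hα (hα.trans hαβ)).def'.aestronglyMeasurable
  · filter_upwards [self_mem_nhdsWithin] with s hs
    refine Eventually.of_forall fun x hx => ?_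
    rw [uIoc_of_le hαβ] at hx
    exact hC s hs x ⟨hα.trans hx.1.le, hx.2⟩
  · simp
  · refine Eventually.of_forall fun x hx => ?_
    rw [uIoc_of_le hαβ] at hx
    exact ContinuousOn.comp (g := Function.uncurry f) (f := fun s => (s, x)) hf (by fun_prop)
      (fun s hs => ⟨hs, hα.trans hx.1.le⟩) t ht

namespace IsC1Field

theorem hasDerivAt_integral (hf : IsC1Field T a f fx ft) (ht : t ∈ Ioo 0 T) (hα : a ≤ α)
    (hαβ : α ≤ β) : HasDerivAt (fun s => ∫ x in α..β, f s x) (∫ x in α..β, ft t x) t := by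
  obtain ⟨C, _, hC⟩ := ContOn.exists_bound hf.cont_dt β
  have hm : ∀ {k : ℝ → ℝ → ℝ}, ContOn T a k → ∀ s ∈ Icc 0 T, IntervalIntegrable (k s) volume α β :=
    fun hk s hs => hk.intervalIntegrable hs hα (hα.trans hαβ)
  refine (intervalIntegral.hasDerivAt_integral_of_dominated_loc_of_deriv_le (𝕜 := ℝ)
    (bound := fun _ => C) (s := Ioo 0 T) (Ioo_mem_nhds ht.1 ht.2) ?_
    (hm hf.cont t (Ioo_subset_Icc_self ht))
    (hm hf.cont_dt t (Ioo_subset_Icc_self ht)).def'.aestronglyMeasurable ?_ (by simp) ?_).2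
  · filter_upwards [Icc_mem_nhds ht.1 ht.2] with s hs
    exact (hm hf.cont s hs).def'.aestronglyMeasurable
  · refine Eventually.of_forall fun x hx s hs => ?_
    rw [uIoc_of_le hαβ] at hx
    exact hC s (Ioo_subset_Icc_self hs) x ⟨hα.trans hx.1.le, hx.2⟩
  · refine Eventually.of_forall fun x hx s hs => ?_
    rw [uIoc_of_le hαβ] at hx
    exact hf.hasDerivAt_dt s hs x (hα.trans hx.1.le)

theorem add (hf : IsC1Field T a f fx ft) (hg : IsC1Field T a g gx gt) :
    IsC1Field T a (fun t x => f t x + g t x) (fun t x => fx t x + gx t x)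
      (fun t x => ft t x + gt t x) :=
  ⟨hf.cont.add hg.cont, hf.cont_dx.add hg.cont_dx, hf.cont_dt.add hg.cont_dt,
    fun t ht x hx => (hf.hasDerivAt_dx t ht x hx).add (hg.hasDerivAt_dx t ht x hx),
    fun t ht x hx => (hf.hasDerivAt_dt t ht x hx).add (hg.hasDerivAt_dt t ht x hx)⟩

theorem mul (hf : IsC1Field T a f fx ft) (hg : IsC1Field T a g gx gt) :
    IsC1Field T a (fun t x => f t x * g t x) (fun t x => fx t x * g t x + f t x * gx t x)
      (fun t x => ft t x * g t x + f t x * gt t x) :=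
  ⟨hf.cont.mul hg.cont, (hf.cont_dx.mul hg.cont).add (hf.cont.mul hg.cont_dx),
    (hf.cont_dt.mul hg.cont).add (hf.cont.mul hg.cont_dt),
    fun t ht x hx => (hf.hasDerivAt_dx t ht x hx).mul (hg.hasDerivAt_dx t ht x hx),
    fun t ht x hx => (hf.hasDerivAt_dt t ht x hx).mul (hg.hasDerivAt_dt t ht x hx)⟩

theorem const_mul (hf : IsC1Field T a f fx ft) (c : ℝ) :
    IsC1Field T a (fun t x => c * f t x) (fun t x => c * fx t x) (fun t x => c * ft t x) :=
  ⟨hf.cont.const_mul c, hf.cont_dx.const_mul c, hf.cont_dt.const_mul c,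
    fun t ht x hx => (hf.hasDerivAt_dx t ht x hx).const_mul c,
    fun t ht x hx => (hf.hasDerivAt_dt t ht x hx).const_mul c⟩

theorem comp {G G' : ℝ → ℝ} (hG : ∀ s, HasDerivAt G (G' s) s) (hG' : Continuous G')
    (hf : IsC1Field T a f fx ft) :
    IsC1Field T a (fun t x => G (f t x)) (fun t x => G' (f t x) * fx t x)
      (fun t x => G' (f t x) * ft t x) := by
  have hGc : Continuous G := continuous_iff_continuousAt.2 fun s => (hG s).continuousAt
  exact ⟨hGc.comp_continuousOn hf.cont, (hG'.comp_continuousOn hf.cont).mul hf.cont_dx,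
    (hG'.comp_continuousOn hf.cont).mul hf.cont_dt,
    fun t ht x hx => (hG _).comp x (hf.hasDerivAt_dx t ht x hx),
    fun t ht x hx => (hG _).comp t (hf.hasDerivAt_dt t ht x hx)⟩

theorem affine (T a c d e : ℝ) :
    IsC1Field T a (fun t x => c + d * t + e * x) (fun _ _ => e) (fun _ _ => d) := by
  refine ⟨?_, continuousOn_const, continuousOn_const, fun t _ x _ => ?_, fun t _ x _ => ?_⟩
  · exact Continuous.continuousOn (f := fun p : ℝ × ℝ => c + d * p.1 + e * p.2) (by fun_prop)
  · simpa using ((hasDerivAt_id x).const_mul e).const_add (c + d * t)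
  · simpa using (((hasDerivAt_id t).const_mul d).const_add c).add_const (e * x)

end IsC1Field

/-! ### Grönwall and transport inequalities -/

/-- Grönwall: `exp (-C t) * y t` is nonincreasing and starts from zero. -/
theorem eq_zero_of_hasDerivAt_le_mul {C : ℝ} {y y' : ℝ → ℝ} (hc : ContinuousOn y (Icc 0 T))
    (hd : ∀ t ∈ Ioo 0 T, HasDerivAt y (y' t) t) (hle : ∀ t ∈ Ioo 0 T, y' t ≤ C * y t)
    (h0 : y 0 = 0) (hy : ∀ t ∈ Icc 0 T, 0 ≤ y t) : ∀ t ∈ Icc 0 T, y t = 0 := by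
  intro t ht
  have hzd : ∀ s ∈ Ioo 0 T, HasDerivAt (fun s => Real.exp (-C * s) * y s)
      (Real.exp (-C * s) * (-C) * y s + Real.exp (-C * s) * y' s) s := fun s hs => by
    have h1 : HasDerivAt (fun s => Real.exp (-C * s)) (Real.exp (-C * s) * (-C)) s := by
      simpa using ((hasDerivAt_id s).const_mul (-C)).exp
    exact h1.mul (hd s hs)
  have hanti : AntitoneOn (fun s => Real.exp (-C * s) * y s) (Icc 0 T) := by
    refine antitoneOn_of_deriv_nonpos (convex_Icc 0 T) ?_ ?_ ?_
    · exact (Continuous.continuousOn (by fun_prop)).mul hc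
    · rw [interior_Icc]
      exact fun s hs => (hzd s hs).differentiableAt.differentiableWithinAt
    · rw [interior_Icc]
      intro s hs
      rw [(hzd s hs).deriv]
      nlinarith [hle s hs, Real.exp_pos (-C * s)]
  have h1 := hanti (left_mem_Icc.2 (ht.1.trans ht.2)) ht ht.1
  simp only [h0, mul_zero] at h1
  have h2 := Real.exp_pos (-C * t)
  exact le_antisymm (nonpos_of_mul_nonpos_right h1 h2) (hy t ht)

theorem IsC1Field.eq_zero_of_integral_dt_le {C : ℝ} (hf : IsC1Field T a f fx ft) (hα : a ≤ α)
    (hαβ : α < β) (hpos : ∀ t ∈ Icc 0 T, ∀ x ∈ Icc α β, 0 ≤ f t x)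
    (hle : ∀ t ∈ Ioo 0 T, ∫ x in α..β, ft t x ≤ C * ∫ x in α..β, f t x)
    (h0 : ∀ x ∈ Icc α β, f 0 x = 0) : ∀ t ∈ Icc 0 T, ∀ x ∈ Icc α β, f t x = 0 := by
  have key := eq_zero_of_hasDerivAt_le_mul (ContOn.continuousOn_integral hf.cont hα hαβ.le)
    (fun t ht => hf.hasDerivAt_integral ht hα hαβ.le) hle ?_
    (fun t ht => intervalIntegral.integral_nonneg hαβ.le (hpos t ht))
  · intro t ht x hx
    by_contra hne
    have : 0 < ∫ x in α..β, f t x := intervalIntegral.integral_pos hαβ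
      ((ContOn.slice hf.cont ht).mono fun y hy => hα.trans hy.1)
      (fun y hy => hpos t ht y (Ioc_subset_Icc_self hy))
      ⟨x, hx, lt_of_le_of_ne (hpos t ht x hx) (Ne.symm hne)⟩
    exact this.ne' (key t ht)
  · rw [intervalIntegral.integral_congr (g := fun _ => 0), intervalIntegral.integral_zero]
    rw [uIcc_of_le hαβ.le]
    exact h0

/-- A nonnegative density transported by a velocity field `u`, which does not cross the end points
and with at most linear growth, stays zero if it is zero initially. -/
theorem IsC1Field.eq_zero_of_transport {u ux ut : ℝ → ℝ → ℝ} {C : ℝ}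
    (hf : IsC1Field T a f fx ft) (hu : IsC1Field T a u ux ut) (hα : a ≤ α)
    (hαβ : α < β) (hpos : ∀ t ∈ Icc 0 T, ∀ x ∈ Icc α β, 0 ≤ f t x)
    (hle : ∀ t ∈ Ioo 0 T, ∀ x ∈ Ioo α β, ft t x + (ux t x * f t x + u t x * fx t x) ≤ C * f t x)
    (hbα : ∀ t ∈ Ioo 0 T, u t α * f t α = 0) (hbβ : ∀ t ∈ Ioo 0 T, u t β * f t β = 0)
    (h0 : ∀ x ∈ Icc α β, f 0 x = 0) : ∀ t ∈ Icc 0 T, ∀ x ∈ Icc α β, f t x = 0 := by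
  refine hf.eq_zero_of_integral_dt_le (C := C) hα hαβ hpos (fun t ht => ?_) h0
  have ht' := Ioo_subset_Icc_self ht
  have huf := hu.mul hf
  -- The flux `u f` vanishes at both ends, so only the time derivative contributes to the integral.
  have h1 := ContOn.integral_dx huf.cont huf.cont_dx ht' (huf.hasDerivAt_dx t ht') hα hαβ.le
  simp only [hbα t ht, hbβ t ht, sub_zero] at h1
  have i1 := ContOn.intervalIntegrable hf.cont_dt ht' hα (hα.trans hαβ.le)
  have i2 := ContOn.intervalIntegrable huf.cont_dx ht' hα (hα.trans hαβ.le)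
  have i3 := (ContOn.intervalIntegrable hf.cont ht' hα (hα.trans hαβ.le)).const_mul C
  have h2 := intervalIntegral.integral_mono_on_of_le_Ioo hαβ.le (i1.add i2) i3 (hle t ht)
  rw [intervalIntegral.integral_add i1 i2, h1, add_zero,
    intervalIntegral.integral_const_mul] at h2
  exact h2

/-- Squaring makes the positive part `C¹`, so negative parts and cut-off weights stay within
`IsC1Field`. -/
theorem hasDerivAt_max_zero_sq (s : ℝ) :
    HasDerivAt (fun s : ℝ => max s 0 ^ 2) (2 * max s 0) s := by
  rcases lt_trichotomy s 0 with hs | rfl | hs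
  · rw [max_eq_right hs.le, mul_zero]
    refine (hasDerivAt_const s (0 : ℝ)).congr_of_eventuallyEq ?_
    filter_upwards [Iio_mem_nhds hs] with y hy
    simp [max_eq_right (le_of_lt (mem_Iio.1 hy))]
  · rw [max_self, mul_zero, hasDerivAt_iff_isLittleO_nhds_zero]
    refine Asymptotics.IsBigO.trans_isLittleO (g := fun h : ℝ => h ^ 2) ?_ ?_
    · refine Asymptotics.isBigO_of_le _ fun h => ?_
      simp only [zero_add, max_self, smul_zero, sub_zero, norm_pow, Real.norm_eq_abs]
      simp only [ne_eq, OfNat.ofNat_ne_zero, not_false_eq_true, zero_pow, sub_zero, abs_pow]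
      refine pow_le_pow_left₀ (abs_nonneg _) ?_ 2
      rcases le_total h 0 with h1 | h1 <;> simp [h1]
    · simpa using Asymptotics.isLittleO_pow_id (one_lt_two)
  · rw [max_eq_left hs.le]
    have : HasDerivAt (fun s : ℝ => s ^ 2) (2 * s) s := by simpa using hasDerivAt_pow 2 s
    refine this.congr_of_eventuallyEq ?_
    filter_upwards [Ioi_mem_nhds hs] with y hy
    rw [max_eq_left (le_of_lt (mem_Ioi.1 hy))]

theorem IsC1Field.max_zero_sq (hf : IsC1Field T a f fx ft) :
    IsC1Field T a (fun t x => max (f t x) 0 ^ 2) (fun t x => 2 * max (f t x) 0 * fx t x)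
      (fun t x => 2 * max (f t x) 0 * ft t x) :=
  hf.comp (G := fun s => max s 0 ^ 2) (G' := fun s => 2 * max s 0) hasDerivAt_max_zero_sq (by fun_prop)

/-- Transported quantities which are nonnegative initially stay nonnegative. -/
theorem IsC1Field.nonneg_of_transport {u ux ut : ℝ → ℝ → ℝ} {k : ℝ}
    (hf : IsC1Field T a f fx ft) (hu : IsC1Field T a u ux ut) (hα : a ≤ α) (hαβ : α < β)
    (hle : ∀ t ∈ Ioo 0 T, ∀ x ∈ Ioo α β, -(k * ux t x * f t x) ≤ ft t x + u t x * fx t x)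
    (hbα : ∀ t ∈ Ioo 0 T, u t α * f t α = 0) (hbβ : ∀ t ∈ Ioo 0 T, u t β * f t β = 0)
    (h0 : ∀ x ∈ Icc α β, 0 ≤ f 0 x) : ∀ t ∈ Icc 0 T, ∀ x ∈ Icc α β, 0 ≤ f t x := by
  obtain ⟨C, hC0, hC⟩ := ContOn.exists_bound hu.cont_dx β
  -- With `n` the negative part of `f`, one has `n * f = -n²`, so `n²` satisfies the transport
  -- inequality with rate `(1 - 2 k) ux`. It vanishes initially, hence always.
  have hQ := (hf.const_mul (-1)).max_zero_sq
  have hb : ∀ v s : ℝ, v * s = 0 → v * max (-1 * s) 0 ^ 2 = 0 := by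
    intro v s h
    rcases mul_eq_zero.1 h with h | h <;> simp [h]
  have key := hQ.eq_zero_of_transport (C := |1 - 2 * k| * C) hu hα hαβ
    (fun t _ x _ => sq_nonneg _) ?_ (fun t ht => hb _ _ (hbα t ht)) (fun t ht => hb _ _ (hbβ t ht)) ?_
  · intro t ht x hx
    have := key t ht x hx
    rw [pow_eq_zero_iff two_ne_zero, max_eq_right_iff] at this
    linarith
  · intro t ht x hx
    have hCx := hC t (Ioo_subset_Icc_self ht) x ⟨hα.trans hx.1.le, hx.2.le⟩
    set n := max (-1 * f t x) 0 with hn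
    have hn0 : 0 ≤ n := le_max_right _ _
    have hnf : n * f t x = -n ^ 2 := by
      rcases le_total (f t x) 0 with h | h
      · rw [hn, max_eq_left (by linarith)]; ring
      · rw [hn, max_eq_right (by linarith)]; ring
    have h1 := mul_le_mul_of_nonneg_left (hle t ht x hx) hn0
    have h2 : n * -(k * ux t x * f t x) = k * ux t x * n ^ 2 := by
      linear_combination (-(k * ux t x)) * hnf
    have h3 : (1 - 2 * k) * ux t x ≤ |1 - 2 * k| * C := by
      refine (le_abs_self _).trans ?_
      rw [abs_mul]
      exact mul_le_mul_of_nonneg_left hCx (abs_nonneg _)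
    have h4 := mul_le_mul_of_nonneg_right h3 (sq_nonneg n)
    linarith
  · intro x hx
    have := h0 x hx
    rw [max_eq_right (by linarith)]
    simp

end calculus

/-! ### Confinement of the gas -/

/-- A classical flow of a viscous ideal gas without heat conduction on `[0, T] × [a, ∞)`, with the
equations in non-conservative form, a wall at `a` and gas at rest at infinity, whose initial density
is supported in `[a, b]`. -/
structure IsGasFlow (R γ ν T a b : ℝ) (ρ ρx ρt u ux uxx ut θ θx θt : ℝ → ℝ → ℝ) : Prop where
  density : IsC1Field T a ρ ρx ρt
  velocity : IsC1Field T a u ux ut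
  temperature : IsC1Field T a θ θx θt
  cont_uxx : ContOn T a uxx
  hasDerivAt_ux : ∀ t ∈ Icc 0 T, ∀ x, a < x → HasDerivAt (ux t) (uxx t x) x
  bounded : ∃ C, ∀ t ∈ Icc 0 T, ∀ x, a ≤ x → |u t x| ≤ C
  mass : ∀ t ∈ Ioo 0 T, ∀ x, a < x → ρt t x + ρx t x * u t x + ρ t x * ux t x = 0
  momentum : ∀ t ∈ Ioo 0 T, ∀ x, a < x →
    ρ t x * (ut t x + u t x * ux t x) + R * (ρx t x * θ t x + ρ t x * θx t x) = ν * uxx t x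
  energy : ∀ t ∈ Ioo 0 T, ∀ x, a < x →
    R / (γ - 1) * (ρ t x * (θt t x + u t x * θx t x)) + R * ρ t x * θ t x * ux t x
      = ν * ux t x ^ 2
  wall : ∀ t ∈ Icc 0 T, u t a = 0
  infty : ∀ t ∈ Icc 0 T, Tendsto (u t) atTop (𝓝 0)
  supp : ∀ x, b ≤ x → ρ 0 x = 0
  initial_density : ∀ x, a ≤ x → 0 ≤ ρ 0 x
  initial_pressure : ∀ x, a ≤ x → 0 ≤ ρ 0 x * θ 0 x

theorem eq_of_hasDerivAt_eq_zero {T : ℝ} {y y' : ℝ → ℝ} (hc : ContinuousOn y (Icc 0 T))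
    (hd : ∀ t ∈ Ioo 0 T, HasDerivAt y (y' t) t) (h0 : ∀ t ∈ Ioo 0 T, y' t = 0) :
    ∀ t ∈ Icc 0 T, y t = y 0 := by
  intro t ht
  have := intervalIntegral.integral_eq_sub_of_hasDerivAt_of_le (f' := fun _ => 0) ht.1
    (hc.mono (Icc_subset_Icc_right ht.2)) (fun s hs => by
      have hs' : s ∈ Ioo 0 T := ⟨hs.1, hs.2.trans_le ht.2⟩
      rw [← h0 s hs']
      exact hd s hs') (by simp)
  rw [intervalIntegral.integral_zero] at this
  linarith

namespace IsGasFlow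

variable {R γ ν T a b : ℝ} {ρ ρx ρt u ux uxx ut θ θx θt : ℝ → ℝ → ℝ}
  (h : IsGasFlow R γ ν T a b ρ ρx ρt u ux uxx ut θ θx θt)
include h

theorem isC1Field_pressure : IsC1Field T a (fun t x => R * (ρ t x * θ t x))
    (fun t x => R * (ρx t x * θ t x + ρ t x * θx t x))
    (fun t x => R * (ρt t x * θ t x + ρ t x * θt t x)) :=
  (h.density.mul h.temperature).const_mul R

/-- Finite speed of propagation. -/
theorem exists_density_eq_zero (hab : a ≤ b) :
    ∃ L, b < L ∧ ∀ t ∈ Icc 0 T, ∀ x, L ≤ x → ρ t x = 0 := by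
  obtain ⟨C₀, hC₀⟩ := h.bounded
  set C := max C₀ 0 with hCdef
  have hC : ∀ t ∈ Icc 0 T, ∀ x, a ≤ x → |u t x| ≤ C :=
    fun t ht x hx => (hC₀ t ht x hx).trans (le_max_left _ _)
  have hC0 : 0 ≤ C := le_max_right _ _
  refine ⟨b + C * |T| + 1, by nlinarith [abs_nonneg T], fun t ht x hx => ?_⟩
  set K := x + C * |T| + 1 with hK
  have hTt : t ≤ |T| := ht.2.trans (le_abs_self T)
  have hCt : C * t ≤ C * |T| := mul_le_mul_of_nonneg_left hTt hC0
  have hCT : 0 ≤ C * |T| := mul_nonneg hC0 (abs_nonneg T)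
  -- The weight lives between fronts that start at `b` and `K` and move inwards with speed `C ≥
  -- |u|`, so it does not increase along the flow and vanishes at both end points. The choice of `L`
  -- and `K` makes it positive at `(t, x)`. It multiplies `ρ²`, as the sign of `ρ` is not yet known.
  have hW := (IsC1Field.affine T a (-b) (-C) 1).max_zero_sq.mul
    (IsC1Field.affine T a K (-C) (-1)).max_zero_sq
  have hQ := hW.mul (h.density.mul h.density)
  obtain ⟨D, hD0, hD⟩ := ContOn.exists_bound h.velocity.cont_dx K
  have key := hQ.eq_zero_of_transport (C := D) (α := b) (β := K) h.velocity hab (by linarith)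
    ?_ ?_ ?_ ?_ ?_ t ht x ⟨by linarith, by linarith⟩
  · have h1 : 0 < max (-b + -C * t + 1 * x) 0 ^ 2 := by
      have : 0 < -b + -C * t + 1 * x := by linarith
      rw [max_eq_left this.le]
      positivity
    have h2 : 0 < max (K + -C * t + -1 * x) 0 ^ 2 := by
      have : 0 < K + -C * t + -1 * x := by linarith
      rw [max_eq_left this.le]
      positivity
    rcases mul_eq_zero.1 key with h3 | h3
    · exact absurd h3 (mul_pos h1 h2).ne'
    · exact mul_self_eq_zero.1 h3
  · intro s _ y _
    have := mul_self_nonneg (ρ s y)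
    positivity
  · intro s hs y hy
    have hs' := Ioo_subset_Icc_self hs
    have hm := h.mass s hs y (lt_of_le_of_lt hab hy.1)
    have hD' := hD s hs' y ⟨hab.trans hy.1.le, hy.2.le⟩
    have hu' := hC s hs' y (hab.trans hy.1.le)
    set p := max (-b + -C * s + 1 * y) 0
    set q := max (K + -C * s + -1 * y) 0
    have hp : 0 ≤ p := le_max_right _ _
    have hq : 0 ≤ q := le_max_right _ _
    have h1 : 0 ≤ 2 * p * q ^ 2 * (ρ s y * ρ s y) * (C - u s y) := by
      have : 0 ≤ C - u s y := by linarith [(abs_le.1 hu').2]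
      have := mul_self_nonneg (ρ s y)
      positivity
    have h2 : 0 ≤ 2 * q * p ^ 2 * (ρ s y * ρ s y) * (C + u s y) := by
      have : 0 ≤ C + u s y := by linarith [(abs_le.1 hu').1]
      have := mul_self_nonneg (ρ s y)
      positivity
    have h3 : 0 ≤ (p ^ 2 * q ^ 2 * (ρ s y * ρ s y)) * (D + ux s y) := by
      have : 0 ≤ D + ux s y := by linarith [(abs_le.1 hD').1]
      have := mul_self_nonneg (ρ s y)
      positivity
    have h4 : ρt s y = -(ρx s y * u s y + ρ s y * ux s y) := by linarith
    rw [h4]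
    linarith
  · intro s hs
    rw [max_eq_right (by nlinarith [mul_nonneg hC0 hs.1.le])]
    ring
  · intro s hs
    rw [max_eq_right (a := K + -C * s + -1 * K) (by nlinarith [mul_nonneg hC0 hs.1.le])]
    ring
  · intro y hy
    rw [h.supp y hy.1]
    ring

/-- The continuity equation is the transport inequality with `k = 1`; the vacuum beyond `L` supplies
a right end point without flux. -/
theorem density_nonneg (hab : a ≤ b) : ∀ t ∈ Icc 0 T, ∀ x, a ≤ x → 0 ≤ ρ t x := by
  obtain ⟨L, hbL, hL⟩ := h.exists_density_eq_zero hab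
  have key := h.density.nonneg_of_transport (k := 1) (α := a) (β := L) h.velocity le_rfl
    (by linarith) ?_ ?_ ?_ (fun x hx => h.initial_density x hx.1)
  · intro t ht x hx
    rcases le_total x L with hxL | hxL
    · exact key t ht x ⟨hx, hxL⟩
    · exact (hL t ht x hxL).ge
  · intro t ht x hx
    linarith [h.mass t ht x hx.1]
  · intro t ht
    rw [h.wall t (Ioo_subset_Icc_self ht), zero_mul]
  · intro t ht
    rw [hL t (Ioo_subset_Icc_self ht) L le_rfl, mul_zero]

/-- The gas velocity vanishes in the vacuum outside the support of the density. -/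
theorem velocity_eq_zero_of_vacuum (hν : 0 < ν) {B : ℝ} (hB : a ≤ B) {t : ℝ} (ht : t ∈ Ioo 0 T)
    (hvac : ∀ x, B ≤ x → ρ t x = 0) :
    (∀ x, B ≤ x → u t x = 0) ∧ ∀ x, B ≤ x → ux t x = 0 := by
  have ht' := Ioo_subset_Icc_self ht
  have huxx : ∀ x, B < x → uxx t x = 0 := by
    intro x hx
    have hρx : ρx t x = 0 := by
      refine (h.density.hasDerivAt_dx t ht' x (lt_of_le_of_lt hB hx)).unique ?_
      refine (hasDerivAt_const x (0 : ℝ)).congr_of_eventuallyEq ?_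
      filter_upwards [Ioi_mem_nhds hx] with y hy
      exact hvac y (le_of_lt hy)
    have := h.momentum t ht x (lt_of_le_of_lt hB hx)
    rw [hvac x hx.le, hρx] at this
    simpa [hν.ne'] using this.symm
  have hux : ∀ x, B ≤ x → ux t x = ux t B := by
    intro x hx
    have h1 : ∫ y in B..x, uxx t y = ux t x - ux t B :=
      ContOn.integral_dx h.velocity.cont_dx h.cont_uxx ht' (h.hasDerivAt_ux t ht') hB hx
    rw [intervalIntegral.integral_congr_Ioo_of_le hx (g := fun _ => 0) fun y hy => huxx y hy.1,
      intervalIntegral.integral_zero] at h1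
    linarith
  have hu : ∀ x, B ≤ x → u t x = u t B + ux t B * (x - B) := by
    intro x hx
    have h1 : ∫ y in B..x, ux t y = u t x - u t B :=
      ContOn.integral_dx h.velocity.cont h.velocity.cont_dx ht' (h.velocity.hasDerivAt_dx t ht') hB hx
    rw [intervalIntegral.integral_congr_Ioo_of_le hx (g := fun _ => ux t B) fun y hy => hux y hy.1.le,
      intervalIntegral.integral_const, smul_eq_mul] at h1
    linarith
  obtain ⟨C, hC⟩ := h.bounded
  have hc : ux t B = 0 := by
    by_contra hne
    have hpos : 0 < |ux t B| := abs_pos.2 hne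
    have hC0 : 0 ≤ C := (abs_nonneg _).trans (hC t ht' B hB)
    -- At this distance the affine velocity has changed by `2 * C + 1`, more than a function bounded
    -- by `C` can.
    set y := (2 * C + 1) / |ux t B| with hy
    have hy0 : 0 ≤ y := by positivity
    have h1 := hC t ht' (B + y) (by linarith)
    rw [hu _ (by linarith)] at h1
    have h2 : |ux t B * (B + y - B)| = 2 * C + 1 := by
      rw [add_sub_cancel_left, abs_mul, abs_of_nonneg hy0, hy]
      field_simp
    have h3 := hC t ht' B hB
    have h4 : |ux t B * (B + y - B)| ≤ |u t B + ux t B * (B + y - B)| + |u t B| := by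
      have := abs_sub (u t B + ux t B * (B + y - B)) (u t B)
      rwa [add_sub_cancel_left] at this
    linarith
  have hd : u t B = 0 := by
    have h1 : Tendsto (u t) atTop (𝓝 (u t B)) := by
      refine tendsto_const_nhds.congr' ?_
      filter_upwards [eventually_ge_atTop B] with x hx
      rw [hu x hx, hc, zero_mul, add_zero]
    exact tendsto_nhds_unique h1 (h.infty t ht')
  exact ⟨fun x hx => by rw [hu x hx, hc, hd]; ring, fun x hx => by rw [hux x hx, hc]⟩

/-- The support of the density does not spread. -/
theorem density_eq_zero (hν : 0 < ν) (hab : a ≤ b) :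
    ∀ t ∈ Icc 0 T, ∀ x, b ≤ x → ρ t x = 0 := by
  obtain ⟨L, hbL, hL⟩ := h.exists_density_eq_zero hab
  have hpos := h.density_nonneg hab
  have haL : a ≤ L := hab.trans hbL.le
  obtain ⟨Cρ, hCρ0, hCρ⟩ := ContOn.exists_bound h.density.cont L
  obtain ⟨Cθ, hCθ0, hCθ⟩ := ContOn.exists_bound (h.temperature.const_mul R).cont L
  have hacc : ContOn T a (fun t x => ut t x + u t x * ux t x) :=
    h.velocity.cont_dt.add (h.velocity.cont.mul h.velocity.cont_dx)
  obtain ⟨Ca, hCa0, hCa⟩ := ContOn.exists_bound hacc L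
  -- This is the constant obtained by integrating the bound on `-ux` below over `[b, L]`.
  set D := (Cθ + Ca * (L - b)) / ν with hD
  have hD0 : 0 ≤ D := div_nonneg (by nlinarith) hν.le
  -- Integrating the momentum equation from `y` to `L`, where `ρ`, `u` and `ux` vanish, bounds `-ux`
  -- at `y` by the density there and the escaped mass `N`. A second integration gives `u t b ≤ D *
  -- N`. The sign of `θ` is not known here; only its boundedness is used.
  have hub : ∀ t ∈ Ioo 0 T, u t b ≤ D * ∫ x in b..L, ρ t x := by
    intro t ht
    have ht' := Ioo_subset_Icc_self ht
    set N := ∫ x in b..L, ρ t x with hN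
    obtain ⟨huL, huxL⟩ := h.velocity_eq_zero_of_vacuum hν haL ht (hL t ht')
    have hux : ∀ y ∈ Icc b L, -ux t y ≤ Cθ / ν * ρ t y + Ca * N / ν := by
      intro y hy
      have hay := hab.trans hy.1
      have e1 : ∫ x in y..L, uxx t x = ux t L - ux t y :=
        ContOn.integral_dx h.velocity.cont_dx h.cont_uxx ht' (h.hasDerivAt_ux t ht') hay hy.2
      have e2 := ContOn.integral_dx h.isC1Field_pressure.cont h.isC1Field_pressure.cont_dx ht'
        (h.isC1Field_pressure.hasDerivAt_dx t ht') hay hy.2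
      have i1 : IntervalIntegrable (fun x => ρ t x * (ut t x + u t x * ux t x)) volume y L :=
        ContOn.intervalIntegrable (ContOn.mul h.density.cont hacc) ht' hay haL
      have i2 := ContOn.intervalIntegrable h.isC1Field_pressure.cont_dx ht' hay haL
      have e3 : ν * ∫ x in y..L, uxx t x = (∫ x in y..L, ρ t x * (ut t x + u t x * ux t x)) +
          ∫ x in y..L, R * (ρx t x * θ t x + ρ t x * θx t x) := by
        rw [← intervalIntegral.integral_const_mul, ← intervalIntegral.integral_add i1 i2]
        exact intervalIntegral.integral_congr_Ioo_of_le hy.2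
          fun x hx => (h.momentum t ht x (lt_of_le_of_lt hay hx.1)).symm
      have i3 := ContOn.intervalIntegrable h.density.cont ht' hay haL
      have e4 : ∫ x in y..L, ρ t x * (ut t x + u t x * ux t x) ≤ Ca * ∫ x in y..L, ρ t x := by
        rw [← intervalIntegral.integral_const_mul]
        refine intervalIntegral.integral_mono_on hy.2 i1 (i3.const_mul Ca) fun x hx => ?_
        rw [mul_comm]
        exact mul_le_mul_of_nonneg_right ((le_abs_self _).trans (hCa t ht' x ⟨hay.trans hx.1, hx.2⟩))
          (hpos t ht' x (hay.trans hx.1))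
      have e5 : ∫ x in y..L, ρ t x ≤ N :=
        intervalIntegral.integral_mono_interval hy.1 hy.2 le_rfl
          ((ae_restrict_iff' measurableSet_Ioc).2 (Eventually.of_forall fun x hx =>
            hpos t ht' x (hab.trans hx.1.le)))
          (ContOn.intervalIntegrable h.density.cont ht' hab haL)
      have e6 : Ca * ∫ x in y..L, ρ t x ≤ Ca * N := mul_le_mul_of_nonneg_left e5 hCa0
      have e7 : -(R * (ρ t y * θ t y)) ≤ Cθ * ρ t y := by
        have := mul_le_mul_of_nonneg_right
          ((neg_le_abs _).trans (hCθ t ht' y ⟨hay, hy.2⟩)) (hpos t ht' y hay)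
        linarith
      rw [hL t ht' L le_rfl, zero_mul, mul_zero] at e2
      rw [huxL L le_rfl] at e1
      have e8 : ν * -ux t y ≤ Cθ * ρ t y + Ca * N := by
        rw [e1, e2] at e3
        linarith
      rw [div_mul_eq_mul_div, ← add_div, le_div_iff₀ hν]
      linarith
    have e1 : ∫ x in b..L, ux t x = u t L - u t b :=
      ContOn.integral_dx h.velocity.cont h.velocity.cont_dx ht' (h.velocity.hasDerivAt_dx t ht')
        hab hbL.le
    have i1 := (ContOn.intervalIntegrable h.density.cont ht' hab haL).const_mul (Cθ / ν)
    have e2 := intervalIntegral.integral_mono_on hbL.le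
      (ContOn.intervalIntegrable h.velocity.cont_dx ht' hab haL).neg (i1.add (by simp)) hux
    rw [intervalIntegral.integral_add i1 (by simp), intervalIntegral.integral_const_mul,
      intervalIntegral.integral_const, ← hN, smul_eq_mul] at e2
    simp only [Pi.neg_apply] at e2
    rw [intervalIntegral.integral_neg, e1, huL L le_rfl] at e2
    refine (le_of_eq (by ring)).trans (e2.trans (le_of_eq ?_))
    rw [hD]
    ring
  -- The mass in `[b, L]` grows at the rate `ρ u` at `b`, hence at most at `Cρ * D` times itself.
  have key := h.density.eq_zero_of_integral_dt_le (C := Cρ * D) hab hbL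
    (fun t ht x hx => hpos t ht x (hab.trans hx.1)) ?_ (fun x hx => h.supp x hx.1)
  · intro t ht x hx
    rcases le_total x L with hxL | hxL
    · exact key t ht x ⟨hx, hxL⟩
    · exact hL t ht x hxL
  · intro t ht
    have ht' := Ioo_subset_Icc_self ht
    have hm := h.density.mul h.velocity
    have e1 := ContOn.integral_dx hm.cont hm.cont_dx ht' (hm.hasDerivAt_dx t ht') hab hbL.le
    rw [hL t ht' L le_rfl, zero_mul, zero_sub] at e1
    have e2 : ∫ x in b..L, ρt t x = -∫ x in b..L, (ρx t x * u t x + ρ t x * ux t x) := by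
      rw [← intervalIntegral.integral_neg]
      refine intervalIntegral.integral_congr_Ioo_of_le hbL.le fun x hx => ?_
      have := h.mass t ht x (lt_of_le_of_lt hab hx.1)
      linarith
    rw [e2, e1, neg_neg]
    have h1 : ρ t b ≤ Cρ := (le_abs_self _).trans (hCρ t ht' b ⟨hab, hbL.le⟩)
    have h2 := hpos t ht' b hab
    have h3 : 0 ≤ ∫ x in b..L, ρ t x :=
      intervalIntegral.integral_nonneg hbL.le fun x hx => hpos t ht' x (hab.trans hx.1)
    have h4 := mul_le_mul_of_nonneg_left (hub t ht) h2
    have h5 := mul_le_mul_of_nonneg_right h1 (mul_nonneg hD0 h3)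
    linarith

/-! ### Conservation laws and the virial argument -/

/-- Mass and energy balance combine to `pt + u px + γ p ux = (γ - 1) ν ux²`, whose right-hand side
is nonnegative: this is the transport inequality with `k = γ`. The end points carry no flux because
of the wall and the vacuum. -/
theorem pressure_nonneg (hR : 0 < R) (hγ : 1 < γ) (hν : 0 < ν) (hab : a < b) :
    ∀ t ∈ Icc 0 T, ∀ x ∈ Icc a b, 0 ≤ R * (ρ t x * θ t x) := by
  have hvac := h.density_eq_zero hν hab.le
  refine h.isC1Field_pressure.nonneg_of_transport (k := γ) h.velocity le_rfl hab ?_ ?_ ?_ ?_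
  · intro t ht x hx
    have h1 := h.mass t ht x hx.1
    have h2 := h.energy t ht x hx.1
    have hγ' : 0 < γ - 1 := by linarith
    have h3 : 0 ≤ (γ - 1) * (ν * ux t x ^ 2) := by positivity
    rw [← h2, mul_add, ← mul_assoc, mul_div_cancel₀ _ hγ'.ne'] at h3
    linear_combination h3 - (R * θ t x) * h1
  · intro t ht
    rw [h.wall t (Ioo_subset_Icc_self ht), zero_mul]
  · intro t ht
    rw [hvac t (Ioo_subset_Icc_self ht) b le_rfl, zero_mul, mul_zero, mul_zero]
  · intro x hx
    exact mul_nonneg hR.le (h.initial_pressure x hx.1)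

theorem integral_density_eq (hν : 0 < ν) (hab : a < b) {t : ℝ} (ht : t ∈ Icc 0 T) :
    ∫ x in a..b, ρ t x = ∫ x in a..b, ρ 0 x := by
  have hm := h.density.mul h.velocity
  have hd : ∀ s ∈ Ioo 0 T, ∫ x in a..b, ρt s x = 0 := by
    intro s hs
    have hs' := Ioo_subset_Icc_self hs
    have e1 := ContOn.integral_dx hm.cont hm.cont_dx hs' (hm.hasDerivAt_dx s hs') le_rfl hab.le
    rw [h.density_eq_zero hν hab.le s hs' b le_rfl, h.wall s hs', zero_mul, mul_zero, sub_zero] at e1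
    rw [← neg_eq_zero, ← intervalIntegral.integral_neg, ← e1]
    refine intervalIntegral.integral_congr_Ioo_of_le hab.le fun x hx => ?_
    have := h.mass s hs x hx.1
    linarith
  exact eq_of_hasDerivAt_eq_zero (ContOn.continuousOn_integral h.density.cont le_rfl hab.le)
    (fun s hs => h.density.hasDerivAt_integral hs le_rfl hab.le) hd t ht

theorem isC1Field_energy : IsC1Field T a
    (fun t x => ρ t x * (1 / 2 * (u t x * u t x) + R / (γ - 1) * θ t x))
    (fun t x => ρx t x * (1 / 2 * (u t x * u t x) + R / (γ - 1) * θ t x) +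
      ρ t x * (1 / 2 * (ux t x * u t x + u t x * ux t x) + R / (γ - 1) * θx t x))
    (fun t x => ρt t x * (1 / 2 * (u t x * u t x) + R / (γ - 1) * θ t x) +
      ρ t x * (1 / 2 * (ut t x * u t x + u t x * ut t x) + R / (γ - 1) * θt t x)) :=
  h.density.mul (((h.velocity.mul h.velocity).const_mul (1 / 2)).add (h.temperature.const_mul _))

theorem integral_energy_eq (hν : 0 < ν) (hab : a < b) {t : ℝ} (ht : t ∈ Icc 0 T) :
    ∫ x in a..b, ρ t x * (1 / 2 * (u t x * u t x) + R / (γ - 1) * θ t x) =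
      ∫ x in a..b, ρ 0 x * (1 / 2 * (u 0 x * u 0 x) + R / (γ - 1) * θ 0 x) := by
  have hE := h.isC1Field_energy
  have hF := h.velocity.mul (hE.add h.isC1Field_pressure)
  have hSc : ContOn T a fun t x => uxx t x * u t x + ux t x * ux t x :=
    (h.cont_uxx.mul h.velocity.cont).add (h.velocity.cont_dx.mul h.velocity.cont_dx)
  refine eq_of_hasDerivAt_eq_zero (ContOn.continuousOn_integral hE.cont le_rfl hab.le)
    (fun s hs => hE.hasDerivAt_integral hs le_rfl hab.le) (fun s hs => ?_) t ht
  have hs' := Ioo_subset_Icc_self hs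
  have hvac := h.density_eq_zero hν hab.le s hs'
  -- Velocity zero at `b` as well as at the wall removes both the energy flux and the work of the
  -- viscous stress.
  have hub := (h.velocity_eq_zero_of_vacuum hν hab.le hs hvac).1 b le_rfl
  have e1 := ContOn.integral_dx hF.cont hF.cont_dx hs' (hF.hasDerivAt_dx s hs') le_rfl hab.le
  have e2 := ContOn.integral_dx (ContOn.mul h.velocity.cont_dx h.velocity.cont) hSc hs'
    (fun x hx => (h.hasDerivAt_ux s hs' x hx).mul (h.velocity.hasDerivAt_dx s hs' x hx))
    le_rfl hab.le
  simp only [hub, h.wall s hs', zero_mul, mul_zero, sub_zero] at e1 e2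
  have i1 := ContOn.intervalIntegrable hF.cont_dx hs' le_rfl hab.le
  have i2 := (ContOn.intervalIntegrable hSc hs' le_rfl hab.le).const_mul ν
  have e3 := intervalIntegral.integral_sub i2 i1
  rw [intervalIntegral.integral_const_mul, e1, e2, mul_zero, sub_zero] at e3
  rw [← e3]
  refine intervalIntegral.integral_congr_Ioo_of_le hab.le fun x hx => ?_
  have h1 := h.mass s hs x hx.1
  have h2 := h.momentum s hs x hx.1
  have h3 := h.energy s hs x hx.1
  linear_combination (1 / 2 * (u s x * u s x) + R / (γ - 1) * θ s x) * h1 + u s x * h2 + h3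

/-- The virial identity. -/
theorem integral_virial_dt (hν : 0 < ν) (hab : a < b) {t : ℝ} (ht : t ∈ Ioo 0 T) :
    ∫ x in a..b, (0 * (ρ t x * u t x) + (-a + 0 * t + 1 * x) * (ρt t x * u t x + ρ t x * ut t x)) =
      ∫ x in a..b, (ρ t x * (u t x * u t x) + R * (ρ t x * θ t x)) := by
  have ht' := Ioo_subset_Icc_self ht
  have hvac := h.density_eq_zero hν hab.le t ht'
  have hub := (h.velocity_eq_zero_of_vacuum hν hab.le ht hvac).1 b le_rfl
  have huxb := (h.velocity_eq_zero_of_vacuum hν hab.le ht hvac).2 b le_rfl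
  -- The weight `x - a` removes the unknown pressure and stress at the wall; at `b` the density and
  -- `ux` vanish. The viscous remainder `∫ ux` vanishes since `u` is zero at both ends.
  have hX := IsC1Field.affine T a (-a) 0 1
  have hP := (h.density.mul (h.velocity.mul h.velocity)).add h.isC1Field_pressure
  have hA := hX.mul hP
  have hBc : ContOn T a fun t x => 1 * ux t x + (-a + 0 * t + 1 * x) * uxx t x :=
    (hX.cont_dx.mul h.velocity.cont_dx).add (hX.cont.mul h.cont_uxx)
  have e1 : _ = (0 : ℝ) := (ContOn.integral_dx hA.cont hA.cont_dx ht' (hA.hasDerivAt_dx t ht')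
    le_rfl hab.le).trans (by simp only [hvac b le_rfl, h.wall t ht']; ring)
  have e2 : _ = (0 : ℝ) := (ContOn.integral_dx (ContOn.mul hX.cont h.velocity.cont_dx) hBc ht'
    (fun x hx => (hX.hasDerivAt_dx t ht' x hx).mul (h.hasDerivAt_ux t ht' x hx))
    le_rfl hab.le).trans (by simp only [huxb]; ring)
  have e3 : _ = (0 : ℝ) := (ContOn.integral_dx h.velocity.cont h.velocity.cont_dx ht'
    (h.velocity.hasDerivAt_dx t ht') le_rfl hab.le).trans (by simp only [hub, h.wall t ht']; ring)
  have i0 := ContOn.intervalIntegrable hP.cont ht' le_rfl hab.le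
  have i1 := ContOn.intervalIntegrable hA.cont_dx ht' le_rfl hab.le
  have i2 := ContOn.intervalIntegrable hBc ht' le_rfl hab.le
  have i3 := ContOn.intervalIntegrable h.velocity.cont_dx ht' le_rfl hab.le
  have e4 := intervalIntegral.integral_add (i0.sub i1) ((i2.sub i3).const_mul ν)
  rw [intervalIntegral.integral_sub i0 i1, intervalIntegral.integral_const_mul,
    intervalIntegral.integral_sub i2 i3, e1, e2, e3, sub_zero, sub_zero, mul_zero, add_zero] at e4
  rw [← e4]
  refine intervalIntegral.integral_congr_Ioo_of_le hab.le fun x hx => ?_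
  have h1 := h.mass t ht x hx.1
  have h2 := h.momentum t ht x hx.1
  linear_combination (x - a) * u t x * h1 + (x - a) * h2

/-- The life span of the flow is bounded in terms of its initial mass and energy. -/
theorem mul_energy_mul_time_le (hR : 0 < R) (hγ : 1 < γ) (hν : 0 < ν) (hab : a < b) (hT : 0 < T) :
    min 2 (γ - 1) * (∫ x in a..b, ρ 0 x * (1 / 2 * (u 0 x * u 0 x) + R / (γ - 1) * θ 0 x)) * T ≤
      2 * ((b - a) * (1 / 2 * (∫ x in a..b, ρ 0 x) +
        ∫ x in a..b, ρ 0 x * (1 / 2 * (u 0 x * u 0 x) + R / (γ - 1) * θ 0 x))) := by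
  set E := ∫ x in a..b, ρ 0 x * (1 / 2 * (u 0 x * u 0 x) + R / (γ - 1) * θ 0 x) with hE
  set M := ∫ x in a..b, ρ 0 x with hM
  set c := R / (γ - 1) with hc
  have hγ' : 0 < γ - 1 := by linarith
  have hRc : R = (γ - 1) * c := by rw [hc]; field_simp
  have hρ := h.density_nonneg hab.le
  have hρθ : ∀ t ∈ Icc 0 T, ∀ x ∈ Icc a b, 0 ≤ c * (ρ t x * θ t x) := fun t ht x hx => by
    have h1 := h.pressure_nonneg hR hγ hν hab t ht x hx
    rw [hRc, mul_assoc] at h1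
    exact nonneg_of_mul_nonneg_right h1 hγ'
  have hV := (IsC1Field.affine T a (-a) 0 1).mul (h.density.mul h.velocity)
  have hPc : ContOn T a fun t x => ρ t x * (u t x * u t x) + R * (ρ t x * θ t x) :=
    ((h.density.mul (h.velocity.mul h.velocity)).add h.isC1Field_pressure).cont
  have hint : ∀ {f : ℝ → ℝ → ℝ}, ContOn T a f → ∀ t ∈ Icc 0 T, IntervalIntegrable (f t) volume a b :=
    fun hf t ht => hf.intervalIntegrable ht le_rfl hab.le
  have hVd : ∀ t ∈ Ioo 0 T, HasDerivAt (fun s => ∫ x in a..b, (-a + 0 * s + 1 * x) * (ρ s x * u s x))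
      (∫ x in a..b, (ρ t x * (u t x * u t x) + R * (ρ t x * θ t x))) t := fun t ht => by
    rw [← h.integral_virial_dt hν hab ht]
    exact hV.hasDerivAt_integral ht le_rfl hab.le
  -- The integrand is twice the kinetic plus `γ - 1` times the internal energy density, both
  -- nonnegative.
  have hlow : ∀ t ∈ Ioo 0 T, min 2 (γ - 1) * E ≤
      ∫ x in a..b, (ρ t x * (u t x * u t x) + R * (ρ t x * θ t x)) := fun t ht => by
    have ht' := Ioo_subset_Icc_self ht
    rw [hE, ← h.integral_energy_eq hν hab ht', ← intervalIntegral.integral_const_mul]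
    refine intervalIntegral.integral_mono_on hab.le
      ((hint h.isC1Field_energy.cont t ht').const_mul _) (hint hPc t ht') fun x hx => ?_
    have h1 : 0 ≤ ρ t x * (u t x * u t x) := mul_nonneg (hρ t ht' x hx.1) (mul_self_nonneg _)
    have h2 := hρθ t ht' x hx
    have h3 := mul_le_mul_of_nonneg_right (min_le_left 2 (γ - 1)) h1
    have h4 := mul_le_mul_of_nonneg_right (min_le_right 2 (γ - 1)) h2
    have h5 : R * (ρ t x * θ t x) = (γ - 1) * (c * (ρ t x * θ t x)) := by rw [← mul_assoc (γ - 1), ← hRc]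
    rw [h5]
    linarith
  -- Here `|u| ≤ 1 / 2 + u² / 2` controls momentum by mass and kinetic energy, and the internal
  -- energy is added for free.
  have hup : ∀ t ∈ Icc 0 T, |∫ x in a..b, (-a + 0 * t + 1 * x) * (ρ t x * u t x)| ≤
      (b - a) * (1 / 2 * M + E) := fun t ht => by
    rw [hE, hM, ← h.integral_energy_eq hν hab ht, ← h.integral_density_eq hν hab ht]
    have i1 := (hint h.density.cont t ht).const_mul (1 / 2)
    have i2 := hint h.isC1Field_energy.cont t ht
    rw [← intervalIntegral.integral_const_mul, ← intervalIntegral.integral_add i1 i2,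
      ← intervalIntegral.integral_const_mul]
    refine (intervalIntegral.abs_integral_le_integral_abs hab.le).trans
      (intervalIntegral.integral_mono_on hab.le (hint hV.cont t ht).abs
        ((i1.add i2).const_mul _) fun x hx => ?_)
    have h1 := hρ t ht x hx.1
    have h2 := hρθ t ht x hx
    have h3 : |u t x| ≤ 1 / 2 + 1 / 2 * (u t x * u t x) := by
      rw [← abs_mul_abs_self (u t x)]
      nlinarith [sq_nonneg (|u t x| - 1)]
    have h4 : |-a + 0 * t + 1 * x| ≤ b - a := by
      rw [abs_le]
      constructor <;> linarith [hx.1, hx.2]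
    rw [abs_mul, abs_mul, abs_of_nonneg h1]
    refine mul_le_mul h4 ?_ (by positivity) (by linarith)
    linarith [mul_le_mul_of_nonneg_left h3 h1]
  have hmono := (convex_Icc 0 T).mul_sub_le_image_sub_of_le_deriv (C := min 2 (γ - 1) * E)
    (ContOn.continuousOn_integral hV.cont le_rfl hab.le)
    (by rw [interior_Icc]; exact fun t ht => (hVd t ht).differentiableAt.differentiableWithinAt)
    (by rw [interior_Icc]; exact fun t ht => by rw [(hVd t ht).deriv]; exact hlow t ht)
    0 (left_mem_Icc.2 hT.le) T (right_mem_Icc.2 hT.le) hT.le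
  have h0 := (abs_le.1 (hup 0 (left_mem_Icc.2 hT.le))).1
  have h1 := (abs_le.1 (hup T (right_mem_Icc.2 hT.le))).2
  rw [sub_zero] at hmono
  refine (hmono.trans (sub_le_sub h1 h0)).trans (le_of_eq ?_)
  ring

theorem integral_energy_pos (hR : 0 < R) (hγ : 1 < γ) (hT : 0 ≤ T) (hab : a < b) {x₀ : ℝ}
    (hx₀ : x₀ ∈ Icc a b) (hρ : 0 < ρ 0 x₀) (hθ : 0 < θ 0 x₀) :
    0 < ∫ x in a..b, ρ 0 x * (1 / 2 * (u 0 x * u 0 x) + R / (γ - 1) * θ 0 x) := by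
  have hc : 0 < R / (γ - 1) := div_pos hR (by linarith)
  refine intervalIntegral.integral_pos hab
    ((ContOn.slice h.isC1Field_energy.cont (left_mem_Icc.2 hT)).mono fun y hy => hy.1)
    (fun x hx => ?_) ⟨x₀, hx₀, ?_⟩
  · have h1 := mul_nonneg (h.initial_density x hx.1.le) (mul_self_nonneg (u 0 x))
    have h2 := mul_nonneg hc.le (h.initial_pressure x hx.1.le)
    linarith
  · have := mul_self_nonneg (u 0 x₀)
    positivity

end IsGasFlow

/-! ### Reduction of the initial-boundary value problem to a half line -/

theorem hasDerivAt_of_comp_mul {σ x f' : ℝ} {f : ℝ → ℝ} (hσ : σ * σ = 1)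
    (hf : HasDerivAt (fun y => f (σ * y)) f' x) : HasDerivAt f (σ * f') (σ * x) := by
  have hs : ∀ z, σ * (σ * z) = z := fun z => by rw [← mul_assoc, hσ, one_mul]
  have h1 : HasDerivAt (fun z => σ * z) σ (σ * x) := by
    simpa using (hasDerivAt_id (σ * x)).const_mul σ
  have h2 : HasDerivAt (fun y => f (σ * y)) f' (σ * (σ * x)) := by rwa [hs]
  have h3 := h2.comp (σ * x) h1
  have h4 : (fun y => f (σ * y)) ∘ (fun z => σ * z) = f := funext fun z => by simp [hs]
  rw [h4, mul_comm] at h3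
  exact h3

/-- The equations are invariant under `x ↦ σ x`, `u ↦ σ u`, and eliminating mass and momentum
balance from the conservative equations gives the non-conservative ones. The hypothesis `σ * a ∉ Ω`
places `σ * a` on the boundary of `Ω`, making it a wall. -/
theorem IsClassicalSolution.exists_isGasFlow {R γ μ lam T : ℝ} {m : ℕ} {Ω : Set ℝ}
    {ρ₀ u₀ θ₀ : ℝ → ℝ} {ρ u θ : ℝ → ℝ → ℝ}
    (sol : IsClassicalSolution R γ μ lam m Ω T ρ₀ u₀ θ₀ ρ u θ) (hm : 2 < m) (hT : 0 < T)
    {σ a b : ℝ} (h : IsHalfLineIn Ω σ a) (ha : σ * a ∉ Ω) (hab : a < b)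
    (hρ₀ : ∀ x, a < x → 0 ≤ ρ₀ (σ * x)) (hcomp : ∀ x, a < x → 0 < ρ₀ (σ * x) → 0 < θ₀ (σ * x))
    (hsupp : ∀ x, b ≤ x → ρ₀ (σ * x) = 0) :
    ∃ ρx ρt ux uxx ut θx θt : ℝ → ℝ → ℝ,
      IsGasFlow R γ (2 * μ + lam) T a b (fun t x => ρ t (σ * x)) ρx ρt
        (fun t x => σ * u t (σ * x)) ux uxx ut (fun t x => θ t (σ * x)) θx θt := by
  obtain ⟨ρx, -, ρt, hρ, -⟩ := sol.rho_class.exists_isC1Field hm hT h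
  obtain ⟨ux, uxx, ut, hu, hcu, hdu, C, hC⟩ := sol.u_class.exists_isC1Field hm hT h
  obtain ⟨θx, -, θt, hθ, -⟩ := sol.theta_class.exists_isC1Field hm hT h
  have hσ : |σ| = 1 := by
    rcases mul_self_eq_one_iff.1 h.sq with rfl | rfl <;> simp
  have hinit : ∀ x, a < x → ρ 0 (σ * x) = ρ₀ (σ * x) ∧ u 0 (σ * x) = u₀ (σ * x) ∧
      θ 0 (σ * x) = θ₀ (σ * x) := fun x hx => sol.initial _ (h.mem x hx)
  -- The data are prescribed in the open set only; signs reach the wall by continuity.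
  have hnonneg : ∀ {f : ℝ → ℝ}, ContinuousOn f (Ici a) → (∀ x, a < x → 0 ≤ f x) →
      ∀ x, a ≤ x → 0 ≤ f x := fun {f} hf hpos x hx =>
    le_on_closure (s := Ioi a) (f := fun _ => (0 : ℝ)) (g := f) hpos continuousOn_const
      (by rwa [closure_Ioi]) (by rwa [closure_Ioi])
  have h0T : (0 : ℝ) ∈ Icc 0 T := left_mem_Icc.2 hT.le
  have dρ : ∀ t ∈ Icc 0 T, ∀ x, a < x → HasDerivAt (ρ t) (σ * ρx t x) (σ * x) :=
    fun t ht x hx => hasDerivAt_of_comp_mul h.sq (hρ.hasDerivAt_dx t ht x hx)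
  have du : ∀ t ∈ Icc 0 T, ∀ x, a < x → HasDerivAt (u t) (σ * ux t x) (σ * x) :=
    fun t ht x hx => hasDerivAt_of_comp_mul h.sq (hu.hasDerivAt_dx t ht x hx)
  have dθ : ∀ t ∈ Icc 0 T, ∀ x, a < x → HasDerivAt (θ t) (σ * θx t x) (σ * x) :=
    fun t ht x hx => hasDerivAt_of_comp_mul h.sq (hθ.hasDerivAt_dx t ht x hx)
  have ddu : ∀ t ∈ Icc 0 T, ∀ x, a < x → HasDerivAt (dx u t) (σ * (σ * uxx t x)) (σ * x) := by
    intro t ht x hx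
    refine hasDerivAt_of_comp_mul h.sq (((hdu t ht x hx).const_mul σ).congr_of_eventuallyEq ?_)
    filter_upwards [Ioi_mem_nhds hx] with y hy
    exact (du t ht y hy).deriv
  have mass : ∀ t ∈ Ioo 0 T, ∀ x, a < x → ρt t x + (σ * ρx t x * u t (σ * x) +
      ρ t (σ * x) * (σ * ux t x)) = 0 := by
    intro t ht x hx
    have ht' := Ioo_subset_Icc_self ht
    have e1 : dt ρ t (σ * x) = _ := (hρ.hasDerivAt_dt t ht x hx.le).deriv
    have e2 : dx (fun s y => ρ s y * u s y) t (σ * x) = _ :=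
      ((dρ t ht' x hx).mul (du t ht' x hx)).deriv
    have := sol.mass_eq t ht _ (h.mem x hx)
    rwa [e1, e2] at this
  have momentum : ∀ t ∈ Ioo 0 T, ∀ x, a < x →
      ρt t x * u t (σ * x) + ρ t (σ * x) * ut t x +
      ((σ * ρx t x * u t (σ * x) + ρ t (σ * x) * (σ * ux t x)) * u t (σ * x) +
        ρ t (σ * x) * u t (σ * x) * (σ * ux t x)) -
      (μ * (σ * (σ * uxx t x) + σ * (σ * uxx t x)) + lam * (σ * (σ * uxx t x))) +
      (R * (σ * ρx t x) * θ t (σ * x) + R * ρ t (σ * x) * (σ * θx t x)) = 0 := by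
    intro t ht x hx
    have ht' := Ioo_subset_Icc_self ht
    have e1 : dt (fun s y => ρ s y * u s y) t (σ * x) = _ :=
      ((hρ.hasDerivAt_dt t ht x hx.le).mul (hu.hasDerivAt_dt t ht x hx.le)).deriv
    have e2 : dx (fun s y => ρ s y * u s y * u s y) t (σ * x) = _ :=
      (((dρ t ht' x hx).mul (du t ht' x hx)).mul (du t ht' x hx)).deriv
    have e3 : dx (stress μ lam u) t (σ * x) = _ :=
      ((((ddu t ht' x hx).add (ddu t ht' x hx)).const_mul μ).add
        ((ddu t ht' x hx).const_mul lam)).deriv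
    have e4 : dx (pressure R ρ θ) t (σ * x) = _ :=
      (((dρ t ht' x hx).const_mul R).mul (dθ t ht' x hx)).deriv
    have := sol.momentum_eq t ht _ (h.mem x hx)
    rwa [e1, e2, e3, e4] at this
  refine ⟨ρx, ρt, fun t x => σ * ux t x, fun t x => σ * uxx t x, fun t x => σ * ut t x, θx, θt,
    hρ, hu.const_mul σ, hθ, hcu.const_mul σ, fun t ht x hx => (hdu t ht x hx).const_mul σ,
    ⟨C, fun t ht x hx => by rw [abs_mul, hσ, one_mul]; exact hC t ht x hx⟩, ?_, ?_, ?_, ?_, ?_,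
    ?_, ?_, ?_⟩
  · intro t ht x hx
    linear_combination mass t ht x hx
  · intro t ht x hx
    linear_combination σ * momentum t ht x hx - σ * u t (σ * x) * mass t ht x hx -
      (R * (ρx t x * θ t (σ * x) + ρ t (σ * x) * θx t x) - (2 * μ + lam) * (σ * uxx t x)) * h.sq
  · intro t ht x hx
    have ht' := Ioo_subset_Icc_self ht
    have e1 : dt (fun s y => ρ s y * energy R γ u θ s y) t (σ * x) = _ :=
      ((hρ.hasDerivAt_dt t ht x hx.le).mul ((((hu.hasDerivAt_dt t ht x hx.le).pow 2).div_const 2).add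
        ((hθ.hasDerivAt_dt t ht x hx.le).const_mul (R / (γ - 1))))).deriv
    have e2 : dx (fun s y => u s y * (ρ s y * energy R γ u θ s y + pressure R ρ θ s y)) t (σ * x) = _ :=
      ((du t ht' x hx).mul (((dρ t ht' x hx).mul ((((du t ht' x hx).pow 2).div_const 2).add
        ((dθ t ht' x hx).const_mul (R / (γ - 1))))).add
          (((dρ t ht' x hx).const_mul R).mul (dθ t ht' x hx)))).deriv
    have e3 : dx (fun s y => stress μ lam u s y * u s y) t (σ * x) = _ :=
      (((((ddu t ht' x hx).add (ddu t ht' x hx)).const_mul μ).add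
        ((ddu t ht' x hx).const_mul lam)).mul (du t ht' x hx)).deriv
    have e4 : dx u t (σ * x) = _ := (du t ht' x hx).deriv
    have e5 := sol.energy_eq t ht _ (h.mem x hx)
    rw [e1, e2, e3] at e5
    simp only [Pi.add_apply, Pi.mul_apply, Pi.pow_apply, e4] at e5
    linear_combination e5 - u t (σ * x) * momentum t ht x hx -
      (u t (σ * x) ^ 2 / 2 + R / (γ - 1) * θ t (σ * x) - u t (σ * x) ^ 2) * mass t ht x hx
  · intro t ht
    have hcl : σ * a ∈ closure Ω := by
      have hmaps : MapsTo (fun x => σ * x) (closure (Ioi a)) (closure Ω) :=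
        MapsTo.closure (fun y hy => h.mem y hy) (by fun_prop)
      exact hmaps (by rw [closure_Ioi]; exact self_mem_Ici)
    have : σ * a ∈ frontier Ω := by
      rw [h.isOpen.frontier_eq]
      exact ⟨hcl, ha⟩
    rw [sol.boundary t ht _ this, mul_zero]
  · intro t ht
    have h1 : Tendsto (fun x => σ * x) atTop (cocompact ℝ ⊓ 𝓟 Ω) := by
      refine tendsto_inf.2 ⟨?_, tendsto_principal.2 ?_⟩
      · exact ((Homeomorph.mulLeft₀ σ (left_ne_zero_of_mul_eq_one h.sq)).isClosedEmbedding
          |>.tendsto_cocompact).mono_left atTop_le_cocompact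
      · filter_upwards [eventually_gt_atTop a] with x hx
        exact h.mem x hx
    simpa using ((sol.u_infty t ht).comp h1).const_mul σ
  · intro x hx
    rw [(hinit x (hab.trans_le hx)).1, hsupp x hx]
  · refine hnonneg (ContOn.slice hρ.cont h0T) fun x hx => ?_
    rw [(hinit x hx).1]
    exact hρ₀ x hx
  · refine hnonneg (ContOn.slice (ContOn.mul hρ.cont hθ.cont) h0T) fun x hx => ?_
    obtain ⟨e1, -, e2⟩ := hinit x hx
    rw [e1, e2]
    rcases (hρ₀ x hx).eq_or_lt with h0 | h0
    · rw [← h0, zero_mul]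
    · exact mul_nonneg h0.le (hcomp x hx h0).le

/-- If some gas lies on a half line with a wall, then the life span of classical solutions is bounded
in terms of the initial data. -/
theorem exists_lifespan_bound {R γ μ lam : ℝ} (hR : 0 < R) (hγ : 1 < γ) (hlam : 0 < 2 * μ + lam)
    {m : ℕ} (hm : 2 < m) {Ω : Set ℝ} {ρ₀ : ℝ → ℝ} (u₀ : ℝ → ℝ) {θ₀ : ℝ → ℝ} {σ a b x₀ : ℝ}
    (h : IsHalfLineIn Ω σ a) (ha : σ * a ∉ Ω) (hab : a < b)
    (hρ₀ : ∀ x, a < x → 0 ≤ ρ₀ (σ * x)) (hcomp : ∀ x, a < x → 0 < ρ₀ (σ * x) → 0 < θ₀ (σ * x))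
    (hsupp : ∀ x, b ≤ x → ρ₀ (σ * x) = 0) (hx₀ : a < x₀) (hpos : 0 < ρ₀ (σ * x₀)) :
    ∃ Tstar : ℝ, 0 < Tstar ∧ ∀ T : ℝ, Tstar < T →
      ¬ ∃ ρ u θ : ℝ → ℝ → ℝ, IsClassicalSolution R γ μ lam m Ω T ρ₀ u₀ θ₀ ρ u θ := by
  set M := ∫ x in a..b, ρ₀ (σ * x) with hM
  set E := ∫ x in a..b, ρ₀ (σ * x) * (1 / 2 * (σ * u₀ (σ * x) * (σ * u₀ (σ * x))) +
    R / (γ - 1) * θ₀ (σ * x)) with hE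
  set B := 2 * ((b - a) * (1 / 2 * M + E)) / (min 2 (γ - 1) * E) with hB
  refine ⟨|B| + 1, by positivity, fun T hT => ?_⟩
  rintro ⟨ρ, u, θ, sol⟩
  -- `B` depends on the data alone. The sign of `E` is established only once a solution is given, so
  -- `|B| + 1` serves as a bound that is positive in any case.
  have hT0 : 0 < T := by linarith [abs_nonneg B]
  obtain ⟨ρx, ρt, ux, uxx, ut, θx, θt, flow⟩ :=
    sol.exists_isGasFlow hm hT0 h ha hab hρ₀ hcomp hsupp
  have hinit : ∀ x, a < x → ρ 0 (σ * x) = ρ₀ (σ * x) ∧ u 0 (σ * x) = u₀ (σ * x) ∧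
      θ 0 (σ * x) = θ₀ (σ * x) := fun x hx => sol.initial _ (h.mem x hx)
  have eM : ∫ x in a..b, ρ 0 (σ * x) = M :=
    intervalIntegral.integral_congr_Ioo_of_le hab.le fun x hx => (hinit x hx.1).1
  have eE : ∫ x in a..b, ρ 0 (σ * x) * (1 / 2 * (σ * u 0 (σ * x) * (σ * u 0 (σ * x))) +
      R / (γ - 1) * θ 0 (σ * x)) = E :=
    intervalIntegral.integral_congr_Ioo_of_le hab.le fun x hx => by
      obtain ⟨h1, h2, h3⟩ := hinit x hx.1
      simp only [h1, h2, h3]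
  have hx₀b : x₀ ≤ b := by
    by_contra hlt
    exact hpos.ne' (hsupp x₀ (not_le.1 hlt).le)
  obtain ⟨h1, -, h3⟩ := hinit x₀ hx₀
  have hE0 := flow.integral_energy_pos hR hγ hT0.le hab (x₀ := x₀) ⟨hx₀.le, hx₀b⟩
    (h1 ▸ hpos) (h3 ▸ hcomp x₀ hx₀ hpos)
  have hle := flow.mul_energy_mul_time_le hR hγ hlam hab hT0
  rw [eE] at hE0
  rw [eE, eM, mul_comm, ← le_div_iff₀ (mul_pos (lt_min two_pos (by linarith)) hE0)] at hle
  linarith [le_abs_self B]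

end CNS1D

theorem theorem1p2
    (R γ μ lam : ℝ) (hR : 0 < R) (hγ : 1 < γ) (hμ : 0 < μ) (hlam : 0 < 2 * μ + lam)
    (m : ℕ) (hm : 2 < m)
    (R₀ : ℝ) (hR₀ : 0 < R₀) (Ω : Set ℝ)
    (hΩ : Ω = {x : ℝ | 0 < x} ∨ ∃ r₀ : ℝ, 0 < r₀ ∧ r₀ < R₀ ∧ Ω = {x : ℝ | r₀ < |x|})
    (ρ₀ u₀ θ₀ : ℝ → ℝ)
    (hρ₀ : CNS1D.InHm m Ω ρ₀) (hu₀ : CNS1D.InHm m Ω u₀) (hθ₀ : CNS1D.InHm m Ω θ₀)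
    (hρ₀_nonneg : ∀ x ∈ Ω, 0 ≤ ρ₀ x)
    (hcomp : ∀ x ∈ Ω, 0 < ρ₀ x → 0 < θ₀ x)
    (hsupp : closure {x : ℝ | x ∈ Ω ∧ ρ₀ x ≠ 0} ⊆ Metric.ball 0 R₀)
    (hmass : 0 < ∫ x in Ω, ρ₀ x) :
    ∃ Tstar : ℝ, 0 < Tstar ∧ ∀ T : ℝ, Tstar < T →
      ¬ ∃ ρ u θ : ℝ → ℝ → ℝ, CNS1D.IsClassicalSolution R γ μ lam m Ω T ρ₀ u₀ θ₀ ρ u θ := by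
  have hopen : IsOpen Ω := by
    rcases hΩ with rfl | ⟨r₀, -, -, rfl⟩
    · exact isOpen_lt continuous_const continuous_id
    · exact isOpen_lt continuous_const continuous_abs
  obtain ⟨y, hyΩ, hy⟩ : ∃ y ∈ Ω, 0 < ρ₀ y := by
    by_contra! hle
    exact hmass.not_ge (setIntegral_nonpos hopen.measurableSet hle)
  -- The half line is the component of `Ω` containing the point `y` where there is gas, and `R₀`
  -- serves as `b`.
  have main : ∀ σ a x₀ : ℝ, CNS1D.IsHalfLineIn Ω σ a → σ * a ∉ Ω → a < R₀ → a < x₀ → σ * x₀ = y →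
      ∃ Tstar : ℝ, 0 < Tstar ∧ ∀ T : ℝ, Tstar < T →
        ¬ ∃ ρ u θ : ℝ → ℝ → ℝ, CNS1D.IsClassicalSolution R γ μ lam m Ω T ρ₀ u₀ θ₀ ρ u θ := by
    intro σ a x₀ h ha haR hax hxy
    refine CNS1D.exists_lifespan_bound hR hγ hlam hm u₀ h ha haR
      (fun x hx => hρ₀_nonneg _ (h.mem x hx)) (fun x hx => hcomp _ (h.mem x hx)) (fun x hx => ?_)
      hax (hxy ▸ hy)
    by_contra hne
    have h1 := hsupp (subset_closure ⟨h.mem x (haR.trans_le hx), hne⟩)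
    have hσ : |σ| = 1 := by
      rcases mul_self_eq_one_iff.1 h.sq with rfl | rfl <;> simp
    rw [mem_ball_zero_iff, Real.norm_eq_abs, abs_mul, hσ, one_mul] at h1
    linarith [le_abs_self x]
  rcases hΩ with rfl | ⟨r₀, hr₀, hrR, rfl⟩
  · exact main 1 0 y ⟨by norm_num, hopen, fun x hx => by simpa using hx⟩ (by simp) hR₀ hyΩ (one_mul y)
  · rcases lt_abs.1 (show r₀ < |y| from hyΩ) with h | h
    · refine main 1 r₀ y ⟨by norm_num, hopen, fun x hx => ?_⟩ ?_ hrR h (one_mul y)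
      · simpa using hx.trans_le (le_abs_self x)
      · simp [abs_of_pos hr₀]
    · refine main (-1) r₀ (-y) ⟨by norm_num, hopen, fun x hx => ?_⟩ ?_ hrR h (by ring)
      · simpa using hx.trans_le (le_abs_self x)
      · simp [abs_of_pos hr₀]
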